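/- Let $q$ be a prime power with $q\equiv1\pmod 4$, let $n\ge1$, let $V$ be a $2n$-dimensional vector space over $\mathbb F_q$ with a nondegenerate alternating bilinear form $B$, and let $\mathcal V$ be the set of subspaces $X\le V$ with $X^\perp=X$ (each has dimension $n$). For $X,Y\in\mathcal V$ let $d(X,Y)$ be the codimension of $X\cap Y$ in $X$. For each $X\in\mathcal V$ fix a nonzero alternating $n$-linear form $\delta_X:X^n\to\mathbb F_q$. For $X,Y\in\mathcal V$ with $d(X,Y)=k$ choose bases $x_1,\dots,x_n$ of $X$ and $y_1,\dots,y_n$ of $Y$ such that $x_i=y_i$ $(k<i\le n)$ is a common basis of $X\cap Y$, and put $$\sigma(X,Y)=\chi\bigl(\delta_X(x_1,\dots,x_n)\,\delta_Y(y_1,\dots,y_n)\,\det[B(x_i,y_j)]_{1\le i,j\le k}\bigr)\in\{\pm1\},$$ where $\chi$ is the quadratic character of $\mathbb F_q$ (the value does not depend on the chosen bases). On $\widehat{\mathcal V}=\mathcal V\times\{\pm1\}$ define, for $0\le k\le n$, $$R_k=\{((X,\varepsilon),(Y,\varepsilon')):d(X,Y)=k,\ \varepsilon\varepsilon'=\sigma(X,Y)\},$$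 $$R_{2n+1-k}=\{((X,\varepsilon),(Y,\varepsilon')):d(X,Y)=k,\ \varepsilon\varepsilon'=-\sigma(X,Y)\},$$ and let $A_0,\dots,A_{2n+1}$ be the adjacency matrices of $R_0,\dots,R_{2n+1}$. Let $r=\sqrt q$, let $\left[{m\atop k}\right]=\prod_{t=0}^{k-1}\frac{q^{m-t}-1}{q^{t+1}-1}$ for integers $m,k\ge 0$, and for $0\le i,j\le n$ put $$\widetilde P_{ij}=\sum_{\ell=0}^{j}(-1)^\ell r^{\,j-2\ell+(j-\ell)^2+\ell^2}\left[{i\atop \ell}\right]\left[{n-i\atop j-\ell}\right],\qquad \widehat P_{ij}=\sum_{\ell=0}^{j}(-1)^\ell r^{\,(j-\ell)^2+\ell^2}\left[{i\atop \ell}\right]\left[{n-i\atop j-\ell}\right].$$ Then $R_0,\dots,R_{2n+1}$ form a symmetric $(2n+1)$-class association scheme $\mathcal S$ on $\widehat{\mathcal V}$. This scheme is $Q$-polynomial: the primitive idempotents of its Bose–Mesner algebra $\mathrm{span}_{\mathbb R}(A_0,\dots,A_{2n+1})$ can be ordered as $E_0,\dots,E_{2n+1}$ such that each $E_j$ is obtained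 by applying a polynomial of degree $j$ to all entries of $E_1$. Moreover, this ordering can be chosen so that the $P$-matrix of $\mathcal S$, defined by $A_j=\sum_{i=0}^{2n+1}P_{i,j}E_i$ for $0\le j\le 2n+1$, is given for $0\le i\le 2n+1$ and $0\le j\le n$ by $$P_{i,j}=P_{i,2n+1-j}=\widetilde P_{i/2,\,j}\quad(i\text{ even}),\qquad P_{i,j}=-P_{i,2n+1-j}=\widehat P_{\lfloor i/2\rfloor,\,j}\quad(i\text{ odd}).$$ -/

import Mathlib

open Module

noncomputable section

namespace DualPolarCover

/-! ### Symmetric association schemes -/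

section Schemes

variable {Ω : Type*} {d : ℕ}

/-- The relations `R 0, …, R d` form a symmetric `d`-class association scheme on `Ω`. -/
structure IsAssociationScheme (R : Fin (d + 1) → Ω → Ω → Prop) : Prop where
  /-- the relations cover `Ω × Ω` and are pairwise disjoint -/
  partition : ∀ x y, ∃! i, R i x y
  /-- the parts are nonempty -/
  nonempty : ∀ i, ∃ x y, R i x y
  /-- the relation with index `0` is the identity relation -/
  diag : ∀ x y, R 0 x y ↔ x = y
  /-- every relation is symmetric -/
  symm : ∀ i x y, R i x y → R i y x
  /-- the intersection numbers exist -/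
  intersection : ∃ p : Fin (d + 1) → Fin (d + 1) → Fin (d + 1) → ℕ,
    ∀ i j k x y, R k x y → Nat.card {z : Ω // R i x z ∧ R j z y} = p i j k

open Classical in
/-- The adjacency matrix `A i` of the relation `R i`. -/
def adjMatrix (R : Fin (d + 1) → Ω → Ω → Prop) (i : Fin (d + 1)) : Matrix Ω Ω ℝ :=
  Matrix.of fun x y => if R i x y then 1 else 0

/-- The Bose-Mesner algebra: the linear span of the adjacency matrices. -/
def boseMesner (R : Fin (d + 1) → Ω → Ω → Prop) : Submodule ℝ (Matrix Ω Ω ℝ) :=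
  Submodule.span ℝ (Set.range (adjMatrix R))

/-- `e` is a primitive idempotent of the Bose-Mesner algebra: a nonzero idempotent that dominates
no idempotents of that algebra besides `0` and itself. -/
structure IsPrimitiveIdempotent [Fintype Ω] (R : Fin (d + 1) → Ω → Ω → Prop)
    (e : Matrix Ω Ω ℝ) : Prop where
  mem : e ∈ boseMesner R
  idem : e * e = e
  ne_zero : e ≠ 0
  minimal : ∀ f ∈ boseMesner R, f * f = f → e * f = f → f * e = f → f = 0 ∨ f = e

/-- `E 0, …, E d` lists all primitive idempotents of the Bose-Mesner algebra, without repetition. -/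
structure IsIdempotentOrdering [Fintype Ω] (R : Fin (d + 1) → Ω → Ω → Prop)
    (E : Fin (d + 1) → Matrix Ω Ω ℝ) : Prop where
  injective : Function.Injective E
  mem_range_iff : ∀ e, e ∈ Set.range E ↔ IsPrimitiveIdempotent R e

/-- `E 0, …, E d` is a `Q`-polynomial ordering of the primitive idempotents: for every `j`, the
matrix `E j` arises by applying a polynomial of degree exactly `j` to every entry of `E 1`. -/
structure IsQPolynomialOrdering [Fintype Ω] (R : Fin (d + 1) → Ω → Ω → Prop)
    (E : Fin (d + 1) → Matrix Ω Ω ℝ) : Prop extends IsIdempotentOrdering R E where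
  polynomial : ∀ j : Fin (d + 1), ∃ p : Polynomial ℝ, p.degree = ((j : ℕ) : WithBot ℕ) ∧
    ∀ x y, E j x y = p.eval (E 1 x y)

/-- `P` is the `P`-matrix of the scheme for the ordering `E 0, …, E d` of its primitive
idempotents: `A j = ∑ i, P i j • E i` for all `j`. -/
def IsPMatrix (R : Fin (d + 1) → Ω → Ω → Prop) (E : Fin (d + 1) → Matrix Ω Ω ℝ)
    (P : Matrix (Fin (d + 1)) (Fin (d + 1)) ℝ) : Prop :=
  ∀ j, adjMatrix R j = ∑ i, P i j • E i

end Schemes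

/-! ### Generators of a symplectic space, and the Maslov index -/

section Symplectic

variable {F : Type*} [Field F] {V : Type*} [AddCommGroup V] [Module F V]

/-- The generators (maximal totally isotropic subspaces): the subspaces `X` with `X^⊥ = X`. -/
abbrev Generator (B : LinearMap.BilinForm F V) : Type _ :=
  {X : Submodule F V // B.orthogonal X = X}

instance instFintypeGenerator [Finite V] (B : LinearMap.BilinForm F V) :
    Fintype (Generator B) :=
  Fintype.ofFinite _

variable {B : LinearMap.BilinForm F V}

/-- The distance of two generators: the codimension of `X ∩ Y` in `X`. -/
def genDist (X Y : Generator B) : ℕ :=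
  finrank F X.1 - finrank F (X.1 ⊓ Y.1 : Submodule F V)

/-- Bases `x` of `X` and `y` of `Y` are adapted to the pair `(X, Y)` at distance `k` if
`x i = y i` for all indices `i` after the first `k`; these `n - k` vectors then form a basis of the
`(n - k)`-dimensional space `X ∩ Y`. -/
def IsAdapted {n : ℕ} {X Y : Generator B} (x : Basis (Fin n) F X.1) (y : Basis (Fin n) F Y.1) :
    Prop :=
  ∀ i : Fin n, genDist X Y ≤ (i : ℕ) → (x i : V) = (y i : V)

/-- For bases `x` of `X` and `y` of `Y`, where `X` and `Y` are at distance `k`, the value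
`χ(δ_X(x_1, …, x_n) δ_Y(y_1, …, y_n) det [B(x_i, y_j) : i, j among the first k indices])`,
with `χ` the quadratic character of `F`. -/
def maslovValue [Fintype F] [DecidableEq F] {n : ℕ} (δ : ∀ X : Generator B, X.1 [⋀^Fin n]→ₗ[F] F)
    {X Y : Generator B} (x : Basis (Fin n) F X.1) (y : Basis (Fin n) F Y.1) : ℤ :=
  quadraticChar F (δ X x * δ Y y *
    Matrix.det (Matrix.of fun i j : {i : Fin n // (i : ℕ) < genDist X Y} =>
      B (x i.1 : V) (y j.1 : V)))

open Classical in
/-- The Maslov index `σ(X, Y)` relative to the determinant functions `δ`: the value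
`maslovValue δ x y` for a choice of adapted bases `x`, `y` (the value does not depend on this
choice, and for generators of a `2n`-dimensional symplectic space adapted bases exist, so that the
last alternative never occurs). -/
def maslovIndex [Fintype F] [DecidableEq F] {n : ℕ} (δ : ∀ X : Generator B, X.1 [⋀^Fin n]→ₗ[F] F)
    (X Y : Generator B) : ℤ :=
  if h : ∃ b : Basis (Fin n) F X.1 × Basis (Fin n) F Y.1, IsAdapted b.1 b.2 then
    maslovValue δ h.choose.1 h.choose.2
  else 1

/-- The vertex set of the double cover: pairs `(X, ε)` with `X` a generator and `ε = ±1`. -/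
abbrev CoverVertex (B : LinearMap.BilinForm F V) : Type _ := Generator B × ℤˣ

/-- The relations `R 0, …, R (2n+1)` on the double cover. For `k ≤ n`, `R k` consists of the pairs
`((X, ε), (Y, ε'))` with `d(X, Y) = k` and `ε ε' = σ(X, Y)`, and `R (2n+1-k)` of those with
`d(X, Y) = k` and `ε ε' = -σ(X, Y)`. -/
def coverRel [Fintype F] [DecidableEq F] {n : ℕ} (δ : ∀ X : Generator B, X.1 [⋀^Fin n]→ₗ[F] F)
    (i : Fin (2 * n + 1 + 1)) (u v : CoverVertex B) : Prop :=
  if (i : ℕ) ≤ n then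
    genDist u.1 v.1 = i ∧ ((u.2 * v.2 : ℤˣ) : ℤ) = maslovIndex δ u.1 v.1
  else
    genDist u.1 v.1 = 2 * n + 1 - i ∧ ((u.2 * v.2 : ℤˣ) : ℤ) = -maslovIndex δ u.1 v.1

end Symplectic

/-! ### The auxiliary matrices -/

/-- The Gaussian coefficient `((q^n-1)(q^(n-1)-1)⋯(q^(n-k+1)-1)) / ((q^k-1)⋯(q-1))`
(if `k > n`, one factor of the numerator is `q^0 - 1 = 0`). -/
def gauss (q : ℝ) (n k : ℕ) : ℝ :=
  (∏ t ∈ Finset.range k, (q ^ (n - t) - 1)) / ∏ t ∈ Finset.range k, (q ^ (t + 1) - 1)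

/-- The entries `P̃_{ij}`, where `r = √q`. -/
def PTilde (q : ℝ) (n i j : ℕ) : ℝ :=
  ∑ l ∈ Finset.range (j + 1), (-1) ^ l *
    Real.sqrt q ^ ((j : ℤ) - 2 * l + ((j : ℤ) - l) ^ 2 + (l : ℤ) ^ 2) *
    gauss q i l * gauss q (n - i) (j - l)

/-- The entries `P̂_{ij}`, where `r = √q`. -/
def PHat (q : ℝ) (n i j : ℕ) : ℝ :=
  ∑ l ∈ Finset.range (j + 1), (-1) ^ l *
    Real.sqrt q ^ ((j - l) ^ 2 + l ^ 2) * gauss q i l * gauss q (n - i) (j - l)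

end DualPolarCover

end

/-! Split the functions on the double cover into those constant on fibres and those changing sign on
fibres. The indicator of εε' = sσ, for a sign s, is (1 + sεε'σ)/2, so each A_j is a lift of the k-th
distance matrix of the generators plus or minus a lift of the same matrix signed by σ
(`adjMatrix_coverRel`). The two kinds of lift annihilate each other, so two families on the
generators remain to be diagonalized.

Both families come from one count, `IsTriangleIndex.mul_apply`. A vector v outside X lies in exactly
one neighbour Z of X. If v is outside X + Y, then Z is farther from Y than X. If v = a + b with a in
X and b in Y, then Z is at the same distance when B(a,b) ≠ 0, and closer when B(a,b) = 0. The index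
satisfies σ(X,Z)σ(Z,Y) = σ(X,Y), except in the middle case, where the factor χ(B(a,b)) appears. For
y outside X the values B(x,y) are equidistributed, so only the sum of the defect over the field
matters: q - 1 without signs, 0 with them. Hence both families obey one three-term recurrence with
parameters ab = q and a - b equal to that sum, namely (q, 1) and (√q, √q). The congruence q ≡ 1 mod
4 enters through χ(-1) = 1, which makes σ symmetric and multiplicative. The index is computed with
bases adapted on arbitrary index sets, since passing to a neighbour may add any index.

The numbers `pEntry` are coefficients of a product of linear factors; a functional equation under X
↦ qX gives them the same recurrence (`pEntry_rec`). As T_(n+1) = 0 and the n + 1 values `pEntry q a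
b n i 1` are distinct, Lagrange interpolation at T_1 yields the idempotents and the P-matrix.

For the Q-polynomial property, `pEntry_eq_dualPoly` exchanges the roles of row and column: at
distance d the i-th idempotent has entries proportional to τ b^(-d) times a polynomial of degree i
in q^(-d), where τ is 1 or σ. The entries of E_1 are proportional to εε'σ r^(-d), with squares
proportional to q^(-d). Interleaving the two families therefore gives even polynomials of degree 2i
and odd ones of degree 2i + 1 in the entries of E_1. -/

noncomputable section

namespace DualPolarCover

open Polynomial

/-! ### Gaussian coefficients and the entries of the `P`-matrix -/

/-- The common generalization of `PTilde` (where `a = q`, `b = 1`) and `PHat`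
(where `a = b = √q`). -/
def pEntry (q a b : ℝ) (n i j : ℕ) : ℝ :=
  ∑ l ∈ Finset.range (j + 1), (-1) ^ l * q ^ ((j - l).choose 2 + l.choose 2) *
    a ^ (j - l) * b ^ l * gauss q i l * gauss q (n - i) (j - l)

/-- The product `(1 + cX)(1 + cqX)⋯(1 + cq^(m-1)X)`. -/
def qProd (q c : ℝ) (m : ℕ) : ℝ[X] := ∏ t ∈ Finset.range m, (1 + C (c * q ^ t) * X)

/-- Substituting qX shifts the factors by one, losing 1 + cX and gaining 1 + cq^m X. All recurrences
in this part are coefficient comparisons in this equation. -/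
theorem qProd_comp (q c : ℝ) (m : ℕ) :
    (qProd q c m).comp (C q * X) * (1 + C c * X) = qProd q c m * (1 + C (c * q ^ m) * X) := by
  induction m with
  | zero => simp [qProd]
  | succ m ih =>
    have h1 : qProd q c (m + 1) = qProd q c m * (1 + C (c * q ^ m) * X) := by
      simp [qProd, Finset.prod_range_succ]
    have h2 : (1 + C (c * q ^ m) * X : ℝ[X]).comp (C q * X) = 1 + C (c * q ^ (m + 1)) * X := by
      simp [pow_succ]; ring
    rw [h1, mul_comp, h2]
    calc _ = ((qProd q c m).comp (C q * X) * (1 + C c * X)) * (1 + C (c * q ^ (m + 1)) * X) := by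
            ring
      _ = _ := by rw [ih]

theorem one_lt_pow_succ {q : ℝ} (hq : 1 < q) (t : ℕ) : 1 < q ^ (t + 1) :=
  one_lt_pow₀ hq (Nat.succ_ne_zero t)

theorem gauss_zero_right (q : ℝ) (m : ℕ) : gauss q m 0 = 1 := by simp [gauss]

theorem gauss_succ_right (q : ℝ) (m j : ℕ) :
    gauss q m (j + 1) = gauss q m j * ((q ^ (m - j) - 1) / (q ^ (j + 1) - 1)) := by
  simp only [gauss, Finset.prod_range_succ]
  rw [mul_div_mul_comm]

theorem gauss_eq_zero_of_lt (q : ℝ) {m j : ℕ} (h : m < j) : gauss q m j = 0 := by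
  rw [gauss, Finset.prod_eq_zero (Finset.mem_range.2 h) (by simp), zero_div]

theorem gauss_pos {q : ℝ} (hq : 1 < q) {m j : ℕ} (h : j ≤ m) : 0 < gauss q m j := by
  refine div_pos (Finset.prod_pos fun t ht => ?_) (Finset.prod_pos fun t _ => ?_)
  · exact sub_pos.2 (one_lt_pow₀ hq (by have := Finset.mem_range.1 ht; omega))
  · exact sub_pos.2 (one_lt_pow_succ hq t)

theorem coeff_one_add_mul_succ (f : ℝ[X]) (c : ℝ) (j : ℕ) :
    (f * (1 + C c * X)).coeff (j + 1) = f.coeff (j + 1) + c * f.coeff j := by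
  rw [show f * (1 + C c * X) = f + C c * (f * X) by ring]
  simp

theorem coeff_one_add_mul_zero (f : ℝ[X]) (c : ℝ) :
    (f * (1 + C c * X)).coeff 0 = f.coeff 0 := by
  simp [mul_coeff_zero]

/-- The `q`-binomial theorem. -/
theorem coeff_qProd {q : ℝ} (hq : 1 < q) (c : ℝ) (m j : ℕ) :
    (qProd q c m).coeff j = q ^ j.choose 2 * c ^ j * gauss q m j := by
  induction j with
  | zero => simp [gauss_zero_right, qProd, coeff_zero_prod]
  | succ j ih =>
    have h := congrArg (fun f => coeff f (j + 1)) (qProd_comp q c m)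
    simp only [coeff_one_add_mul_succ, comp_C_mul_X_coeff] at h
    have hne : q ^ (j + 1) - 1 ≠ 0 := (sub_pos.2 (one_lt_pow_succ hq j)).ne'
    have h' : (qProd q c m).coeff (j + 1) * (q ^ (j + 1) - 1) =
        c * (q ^ m - q ^ j) * (qProd q c m).coeff j := by linarith
    -- The factor `gauss q m j` is kept because for j > m the truncated exponent m - j makes the
    -- bare identity false, while the coefficient vanishes.
    have hkey : (q ^ m - q ^ j) * gauss q m j = q ^ j * (q ^ (m - j) - 1) * gauss q m j := by
      rcases le_or_gt j m with hjm | hjm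
      · obtain ⟨s, rfl⟩ := Nat.exists_eq_add_of_le hjm
        rw [Nat.add_sub_cancel_left]; ring
      · rw [gauss_eq_zero_of_lt q hjm]; ring
    rw [← mul_left_inj' hne, h', ih, gauss_succ_right, Nat.choose_succ_succ' j 1,
      Nat.choose_one_right]
    field_simp
    calc _ = q ^ j.choose 2 * c ^ (j + 1) * ((q ^ m - q ^ j) * gauss q m j) := by ring
      _ = _ := by rw [hkey]; ring

/-- The generating polynomial of the numbers `pEntry q a b n i j` over `j`. -/
def pGen (q a b : ℝ) (n i : ℕ) : ℝ[X] := qProd q (-b) i * qProd q a (n - i)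

theorem coeff_pGen {q : ℝ} (hq : 1 < q) (a b : ℝ) (n i j : ℕ) :
    (pGen q a b n i).coeff j = pEntry q a b n i j := by
  rw [pGen, coeff_mul, Finset.Nat.sum_antidiagonal_eq_sum_range_succ_mk, pEntry]
  refine Finset.sum_congr rfl fun l _ => ?_
  rw [coeff_qProd hq, coeff_qProd hq, neg_pow]
  ring

theorem pEntry_zero (q a b : ℝ) (n i : ℕ) : pEntry q a b n i 0 = 1 := by
  simp [pEntry, gauss_zero_right]

theorem pEntry_eq_zero_of_lt (q a b : ℝ) {n i j : ℕ} (hi : i ≤ n) (hj : n < j) :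
    pEntry q a b n i j = 0 := by
  refine Finset.sum_eq_zero fun l _ => ?_
  rcases le_or_gt l i with h | h
  · rw [gauss_eq_zero_of_lt q (show n - i < j - l by omega), mul_zero]
  · rw [gauss_eq_zero_of_lt q h]; ring

/-- Two shift equations multiplied together; the factors on either side are quadratic, so
coefficient comparison gives a three-term relation. -/
theorem pGen_comp (q a b : ℝ) (n i : ℕ) :
    (pGen q a b n i).comp (C q * X) * (1 + C (-b) * X) * (1 + C a * X) =
      pGen q a b n i * (1 + C (-b * q ^ i) * X) * (1 + C (a * q ^ (n - i)) * X) := by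
  have h1 := qProd_comp q (-b) i
  have h2 := qProd_comp q a (n - i)
  calc _ = ((qProd q (-b) i).comp (C q * X) * (1 + C (-b) * X)) *
        ((qProd q a (n - i)).comp (C q * X) * (1 + C a * X)) := by
        rw [pGen, mul_comp]; ring
    _ = _ := by rw [h1, h2, pGen]; ring

theorem pEntry_one {q : ℝ} (hq : 1 < q) (a b : ℝ) (n i : ℕ) :
    (q - 1) * pEntry q a b n i 1 = a * (q ^ (n - i) - 1) - b * (q ^ i - 1) := by
  have h := congrArg (fun f => coeff f 1) (pGen_comp q a b n i)
  simp only [coeff_one_add_mul_succ _ _ 0, zero_add, coeff_one_add_mul_zero, comp_C_mul_X_coeff,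
    coeff_pGen hq, pEntry_zero] at h
  linarith

/-- Comparing coefficients of X^(k+2) in `pGen_comp`. The quadratic coefficient on the right is -ab
q^n, free of i, and the linear one is an affine function of `pEntry q a b n i 1`. Hence i enters the
recurrence only through that eigenvalue. -/
theorem pEntry_rec {q a b : ℝ} (hq : 1 < q) (hab : a * b = q) {n i : ℕ} (hi : i ≤ n) (k : ℕ) :
    (q - 1) * pEntry q a b n i 1 * pEntry q a b n i (k + 1) =
      (q ^ (n + 1) - q ^ (k + 1)) * pEntry q a b n i k +
      (a - b) * (q ^ (k + 1) - 1) * pEntry q a b n i (k + 1) +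
      (q ^ (k + 2) - 1) * pEntry q a b n i (k + 2) := by
  have h := congrArg (fun f => coeff f (k + 2)) (pGen_comp q a b n i)
  simp only [coeff_one_add_mul_succ, comp_C_mul_X_coeff, coeff_pGen hq] at h
  rw [pEntry_one hq]
  have h1 : q ^ (n + 1) = (a * b) * (q ^ i * q ^ (n - i)) := by
    rw [← pow_add, Nat.add_sub_cancel' hi, hab, pow_succ']
  rw [h1]
  linear_combination -h - q ^ k * pEntry q a b n i k * hab

/-- Up to a constant the value is (a q^(n-i) - b q^i)/(q - 1), strictly decreasing in i. -/
theorem pEntry_one_injOn {q a b : ℝ} (hq : 1 < q) (ha : 0 < a) (hb : 0 < b) (n : ℕ) :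
    Set.InjOn (fun i => pEntry q a b n i 1) (Finset.range (n + 1)) := by
  have hlt : ∀ i j, i < j → j ≤ n → pEntry q a b n j 1 < pEntry q a b n i 1 := by
    intro i j hij hj
    have h1 : q ^ (n - j) < q ^ (n - i) := pow_lt_pow_right₀ hq (by omega)
    have h2 : q ^ i < q ^ j := pow_lt_pow_right₀ hq hij
    have h3 : 0 < q - 1 := by linarith
    refine lt_of_mul_lt_mul_left ?_ h3.le
    rw [pEntry_one hq, pEntry_one hq]
    have := mul_lt_mul_of_pos_left h1 ha
    have := mul_lt_mul_of_pos_left h2 hb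
    linarith
  intro i hi j hj h
  simp only [Finset.coe_range, Set.mem_Iio] at hi hj
  rcases lt_trichotomy i j with hij | hij | hij
  · exact absurd h (hlt i j hij (by omega)).ne'
  · exact hij
  · exact absurd h (hlt j i hij (by omega)).ne

/-! ### Dual expression of the entries -/

theorem prod_qPow_sub_one_mul (q : ℝ) {m j : ℕ} (h : j ≤ m) :
    (∏ t ∈ Finset.range j, (q ^ (m - t) - 1)) * ∏ t ∈ Finset.range (m - j), (q ^ (t + 1) - 1) =
      ∏ t ∈ Finset.range m, (q ^ (t + 1) - 1) := by
  induction j with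
  | zero => simp
  | succ j ih =>
    rw [← ih (by omega), Finset.prod_range_succ, show m - j = (m - (j + 1)) + 1 by omega,
      Finset.prod_range_succ]
    ring

theorem qFactorial_pos {q : ℝ} (hq : 1 < q) (m : ℕ) :
    0 < ∏ t ∈ Finset.range m, (q ^ (t + 1) - 1) :=
  Finset.prod_pos fun t _ => sub_pos.2 (one_lt_pow_succ hq t)

theorem gauss_eq_qFactorial {q : ℝ} (hq : 1 < q) {m j : ℕ} (h : j ≤ m) :
    gauss q m j = (∏ t ∈ Finset.range m, (q ^ (t + 1) - 1)) /
      ((∏ t ∈ Finset.range j, (q ^ (t + 1) - 1)) *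
        ∏ t ∈ Finset.range (m - j), (q ^ (t + 1) - 1)) := by
  rw [gauss, ← prod_qPow_sub_one_mul q h, mul_div_mul_right _ _ (qFactorial_pos hq _).ne']

/-- In q-factorials both sides are the q-multinomial coefficient of n with parts l, i - l, k - l and
n - i - k + l, which is symmetric in i and k; if the last part is negative, both vanish. -/
theorem gauss_mul_gauss_swap {q : ℝ} (hq : 1 < q) {n i k l : ℕ} (hi : i ≤ n) (hk : k ≤ n)
    (hli : l ≤ i) (hlk : l ≤ k) :
    gauss q n i * (gauss q i l * gauss q (n - i) (k - l)) =
      gauss q n k * (gauss q k l * gauss q (n - k) (i - l)) := by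
  rcases le_or_gt (i + k) (n + l) with h | h
  · rw [gauss_eq_qFactorial hq hi, gauss_eq_qFactorial hq hk, gauss_eq_qFactorial hq hli,
      gauss_eq_qFactorial hq hlk, gauss_eq_qFactorial hq (show k - l ≤ n - i by omega),
      gauss_eq_qFactorial hq (show i - l ≤ n - k by omega),
      show n - i - (k - l) = n - k - (i - l) by omega]
    have hp := fun m => (qFactorial_pos hq m).ne'
    have h1 := hp i
    have h2 := hp (n - i)
    have h3 := hp k
    have h4 := hp (n - k)
    have h5 := hp l
    have h6 := hp (i - l)
    have h7 := hp (k - l)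
    have h8 := hp (n - k - (i - l))
    field_simp
  · rw [gauss_eq_zero_of_lt q (show n - i < k - l by omega),
      gauss_eq_zero_of_lt q (show n - k < i - l by omega)]
    simp

/-- The polynomial of degree `i` that describes the `i`-th row of the `P`-matrix. -/
def dualPoly (q a b : ℝ) (n i : ℕ) : ℝ[X] :=
  ∑ l ∈ Finset.range (i + 1),
    C (q ^ (l ^ 2) * (b / a) ^ l / ((∏ t ∈ Finset.range l, (q ^ (t + 1) - 1)) *
      (∏ t ∈ Finset.range (i - l), (q ^ (t + 1) - 1)))) *
    ((∏ t ∈ Finset.range l, (X - C ((q ^ t)⁻¹))) *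
      ∏ t ∈ Finset.range (i - l), (C (q ^ (n - t)) * X - 1))

/-- Every summand has degree i with positive leading coefficient, so nothing cancels. -/
theorem degree_dualPoly {q a b : ℝ} (hq : 1 < q) (ha : 0 < a) (hb : 0 < b) (n i : ℕ) :
    (dualPoly q a b n i).degree = (i : WithBot ℕ) := by
  have hq0 : 0 < q := by linarith
  have hd1 : ∀ l, (∏ t ∈ Finset.range l, (X - C ((q ^ t)⁻¹) : ℝ[X])).natDegree ≤ l := by
    intro l
    refine (natDegree_prod_le _ _).trans ((Finset.sum_le_card_nsmul _ _ 1 fun t _ => ?_).trans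
      (by simp))
    exact natDegree_X_sub_C_le _
  have hd0 : ∀ c : ℝ, (C c * X - 1 : ℝ[X]).natDegree ≤ 1 := by
    intro c; compute_degree
  have hd2 : ∀ m, (∏ t ∈ Finset.range m, (C (q ^ (n - t)) * X - 1 : ℝ[X])).natDegree ≤ m := by
    intro m
    refine (natDegree_prod_le _ _).trans ((Finset.sum_le_card_nsmul _ _ 1 fun t _ => ?_).trans
      (by simp))
    exact hd0 _
  have hc1 : ∀ l, (∏ t ∈ Finset.range l, (X - C ((q ^ t)⁻¹) : ℝ[X])).coeff l = 1 := by
    intro l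
    have := coeff_prod_of_natDegree_le (Finset.range l) (fun t => (X - C ((q ^ t)⁻¹) : ℝ[X])) 1
      (fun t _ => natDegree_X_sub_C_le _)
    simpa [coeff_X, coeff_C] using this
  have hc2 : ∀ m, 0 < (∏ t ∈ Finset.range m, (C (q ^ (n - t)) * X - 1 : ℝ[X])).coeff m := by
    intro m
    have := coeff_prod_of_natDegree_le (Finset.range m)
      (fun t => (C (q ^ (n - t)) * X - 1 : ℝ[X])) 1 (fun t _ => hd0 _)
    rw [Finset.card_range, mul_one] at this
    rw [this]
    refine Finset.prod_pos fun t _ => ?_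
    have := pow_pos hq0 (n - t)
    simp only [coeff_sub, coeff_C_mul, coeff_X_one, coeff_one]
    simpa using this
  have hle : (dualPoly q a b n i).natDegree ≤ i := by
    refine natDegree_sum_le_of_forall_le _ _ fun l hl => ?_
    refine (natDegree_C_mul_le _ _).trans (natDegree_mul_le.trans ?_)
    have := hd1 l
    have := hd2 (i - l)
    have := Finset.mem_range.1 hl
    omega
  have hco : 0 < (dualPoly q a b n i).coeff i := by
    rw [dualPoly, finsetSum_coeff]
    refine Finset.sum_pos (fun l hl => ?_) ⟨0, by simp⟩
    have hl' : l + (i - l) = i := by have := Finset.mem_range.1 hl; omega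
    have := coeff_mul_add_eq_of_natDegree_le (hd1 l) (hd2 (i - l))
    rw [hl', hc1, one_mul] at this
    rw [coeff_C_mul, this]
    have := qFactorial_pos hq l
    have := qFactorial_pos hq (i - l)
    have := hc2 (i - l)
    positivity
  exact degree_eq_of_le_of_coeff_ne_zero (natDegree_le_iff_degree_le.1 hle) hco.ne'

/-- Together with `gauss_sub_eq_prod` this displays the dependence on k as a polynomial in q^(-k),
apart from the power q^(kl). For l > k both sides contain a zero factor, at t = k. -/
theorem gauss_eq_prod_inv_sub {q : ℝ} (hq : 1 < q) (k l : ℕ) :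
    (-1) ^ l * gauss q k l = q ^ (k * l) * (∏ t ∈ Finset.range l, ((q ^ k)⁻¹ - (q ^ t)⁻¹)) /
      ∏ t ∈ Finset.range l, (q ^ (t + 1) - 1) := by
  have hq0 : q ≠ 0 := by linarith
  rw [gauss, ← mul_div_assoc]
  congr 1
  rcases le_or_gt l k with h | h
  · rw [pow_mul, show ((-1 : ℝ) ^ l) = ∏ t ∈ Finset.range l, (-1) by simp,
      show (q ^ k) ^ l = ∏ t ∈ Finset.range l, q ^ k by simp, ← Finset.prod_mul_distrib,
      ← Finset.prod_mul_distrib]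
    refine Finset.prod_congr rfl fun t ht => ?_
    obtain ⟨s, rfl⟩ := Nat.exists_eq_add_of_le ((Finset.mem_range.1 ht).le.trans h)
    rw [Nat.add_sub_cancel_left, pow_add]
    field_simp
    ring
  · rw [Finset.prod_eq_zero (Finset.mem_range.2 h) (by simp),
      Finset.prod_eq_zero (Finset.mem_range.2 h) (by simp), mul_zero, mul_zero]

theorem gauss_sub_eq_prod {q : ℝ} (hq : 1 < q) {n k m : ℕ} (hk : k ≤ n) :
    gauss q (n - k) m = (∏ t ∈ Finset.range m, (q ^ (n - t) * (q ^ k)⁻¹ - 1)) /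
      ∏ t ∈ Finset.range m, (q ^ (t + 1) - 1) := by
  have hq0 : q ≠ 0 := by linarith
  rw [gauss]
  congr 1
  rcases le_or_gt m (n - k) with h | h
  · refine Finset.prod_congr rfl fun t ht => ?_
    have ht := Finset.mem_range.1 ht
    rw [show n - t = (n - k - t) + k by omega, pow_add]
    field_simp
  · rw [Finset.prod_eq_zero (Finset.mem_range.2 h) (by simp),
      Finset.prod_eq_zero (Finset.mem_range.2 h)]
    rw [Nat.sub_sub_self hk, mul_inv_cancel₀ (pow_ne_zero _ hq0), sub_self]

theorem choose_two_add_sq {k l : ℕ} (h : l ≤ k) :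
    (k - l).choose 2 + l.choose 2 + k * l = k.choose 2 + l ^ 2 := by
  obtain ⟨m, rfl⟩ := Nat.exists_eq_add_of_le h
  rw [Nat.add_sub_cancel_left]
  have : (((m.choose 2 + l.choose 2 + (l + m) * l : ℕ) : ℚ)) =
      ((l + m).choose 2 + l ^ 2 : ℕ) := by
    push_cast [Nat.cast_choose_two]
    ring
  exact_mod_cast this

/-- The duality between rows and columns. `gauss_mul_gauss_swap` moves the dependence on k into
Gaussian coefficients that are polynomial in q^(-k), and `choose_two_add_sq` balances the powers of
q. Both sums are first cut down to l ≤ min i k, beyond which their terms vanish. -/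
theorem pEntry_eq_dualPoly {q a b : ℝ} (hq : 1 < q) (ha : 0 < a) {n i k : ℕ}
    (hi : i ≤ n) (hk : k ≤ n) :
    gauss q n i * pEntry q a b n i k =
      q ^ k.choose 2 * a ^ k * gauss q n k * (dualPoly q a b n i).eval ((q ^ k)⁻¹) := by
  have hq0 : 0 < q := by linarith
  have h1 : gauss q n i * pEntry q a b n i k = ∑ l ∈ Finset.range (min i k + 1),
      q ^ k.choose 2 * a ^ k * gauss q n k *
      (q ^ (l ^ 2) * (b / a) ^ l * (q ^ (k * l))⁻¹ *
        ((-1) ^ l * gauss q k l * gauss q (n - k) (i - l))) := by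
    rw [pEntry, Finset.mul_sum]
    refine (Finset.sum_subset_zero_on_sdiff (Finset.range_mono (by omega)) (fun l hl => ?_)
      fun l hl => ?_).symm
    · have : i < l := by
        simp only [Finset.mem_sdiff, Finset.mem_range] at hl; omega
      rw [gauss_eq_zero_of_lt q this]; ring
    · have hlk : l ≤ k := by have := Finset.mem_range.1 hl; omega
      have hli : l ≤ i := by have := Finset.mem_range.1 hl; omega
      have hs := gauss_mul_gauss_swap hq hi hk hli hlk
      have hc : q ^ ((k - l).choose 2 + l.choose 2) * q ^ (k * l) =
          q ^ k.choose 2 * q ^ (l ^ 2) := by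
        rw [← pow_add, ← pow_add, choose_two_add_sq hlk]
      have ha' : a ^ k = a ^ (k - l) * a ^ l := by rw [← pow_add, Nat.sub_add_cancel hlk]
      rw [ha', div_pow]
      field_simp
      linear_combination (-b ^ l) * (gauss q n k * (gauss q k l * gauss q (n - k) (i - l)) * hc +
        q ^ ((k - l).choose 2 + l.choose 2) * q ^ (k * l) * hs)
  have h2 : (dualPoly q a b n i).eval ((q ^ k)⁻¹) = ∑ l ∈ Finset.range (min i k + 1),
      (q ^ (l ^ 2) * (b / a) ^ l * (q ^ (k * l))⁻¹ *
        ((-1) ^ l * gauss q k l * gauss q (n - k) (i - l))) := by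
    rw [dualPoly, eval_finsetSum]
    refine (Finset.sum_subset_zero_on_sdiff (Finset.range_mono (by omega)) (fun l hl => ?_)
      fun l hl => ?_).symm
    · have : k < l := by
        simp only [Finset.mem_sdiff, Finset.mem_range] at hl; omega
      simp only [eval_mul, eval_prod, eval_sub, eval_X, eval_C]
      have h0 : ∏ t ∈ Finset.range l, ((q ^ k)⁻¹ - (q ^ t)⁻¹) = 0 :=
        Finset.prod_eq_zero (Finset.mem_range.2 this) (sub_self _)
      rw [h0]
      ring
    · rw [gauss_eq_prod_inv_sub hq, gauss_sub_eq_prod hq hk]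
      simp only [eval_mul, eval_prod, eval_sub, eval_X, eval_C, eval_one]
      field_simp
  rw [h1, h2, Finset.mul_sum]

theorem PHat_eq_pEntry {q : ℝ} (hq : 0 ≤ q) (n i j : ℕ) :
    PHat q n i j = pEntry q (Real.sqrt q) (Real.sqrt q) n i j := by
  refine Finset.sum_congr rfl fun l _ => ?_
  have hsq : ∀ m : ℕ, Real.sqrt q ^ m ^ 2 = q ^ m.choose 2 * Real.sqrt q ^ m := by
    intro m
    have h : m ^ 2 = 2 * m.choose 2 + m := by
      have : ((m ^ 2 : ℕ) : ℚ) = (2 * m.choose 2 + m : ℕ) := by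
        push_cast [Nat.cast_choose_two]; ring
      exact_mod_cast this
    rw [h, pow_add, pow_mul, Real.sq_sqrt hq]
  rw [pow_add, pow_add, hsq, hsq]
  ring

theorem PTilde_eq_pEntry {q : ℝ} (hq : 0 ≤ q) (n i j : ℕ) :
    PTilde q n i j = pEntry q q 1 n i j := by
  refine Finset.sum_congr rfl fun l hl => ?_
  have hl : l ≤ j := by have := Finset.mem_range.1 hl; omega
  -- The exponent of √q is even and nonnegative, although j - 2l alone may be negative.
  have h : (j : ℤ) - 2 * l + ((j : ℤ) - l) ^ 2 + (l : ℤ) ^ 2 =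
      ((2 * ((j - l).choose 2 + l.choose 2 + (j - l)) : ℕ) : ℤ) := by
    obtain ⟨m, rfl⟩ := Nat.exists_eq_add_of_le hl
    have : ((((l + m : ℕ) : ℤ) - 2 * l + (((l + m : ℕ) : ℤ) - l) ^ 2 + (l : ℤ) ^ 2 : ℤ) : ℚ) =
        (2 * (m.choose 2 + l.choose 2 + m) : ℕ) := by
      push_cast [Nat.cast_choose_two]; ring
    rw [Nat.add_sub_cancel_left]
    exact_mod_cast this
  rw [h, zpow_natCast, pow_mul, Real.sq_sqrt hq, pow_add, one_pow]
  ring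

attribute [irreducible] pEntry dualPoly

/-! ### Spectra of matrices with a three-term recurrence -/

/-- A family expressed through `E` that is linearly independent and of the same size has the same
span, and `E` is linearly independent as well. -/
theorem linearIndependent_and_span_eq_of_eq_sum {ι M : Type*} [Fintype ι] [AddCommGroup M]
    [Module ℝ M] {A E : ι → M} {P : ι → ι → ℝ} (hA : LinearIndependent ℝ A)
    (h : ∀ j, A j = ∑ i, P i j • E i) :
    LinearIndependent ℝ E ∧
      Submodule.span ℝ (Set.range A) = Submodule.span ℝ (Set.range E) := by
  have hle : Submodule.span ℝ (Set.range A) ≤ Submodule.span ℝ (Set.range E) := by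
    rw [Submodule.span_le]
    rintro _ ⟨j, rfl⟩
    rw [h]
    exact Submodule.sum_mem _ fun i _ =>
      Submodule.smul_mem _ _ (Submodule.subset_span ⟨i, rfl⟩)
  have hfin : Module.Finite ℝ (Submodule.span ℝ (Set.range E)) :=
    Module.Finite.span_of_finite ℝ (Set.finite_range E)
  have h1 : Fintype.card ι = finrank ℝ (Submodule.span ℝ (Set.range A)) :=
    (linearIndependent_iff_card_eq_finrank_span.1 hA)
  have h2 : finrank ℝ (Submodule.span ℝ (Set.range E)) ≤ Fintype.card ι :=
    finrank_range_le_card E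
  have h3 := Submodule.finrank_mono hle
  refine ⟨linearIndependent_iff_card_eq_finrank_span.2 ?_,
    Submodule.eq_of_le_of_finrank_le hle (by omega)⟩
  change _ = finrank ℝ (Submodule.span ℝ (Set.range E))
  omega

/-- The matrices `T 0, …, T n` are symmetric, orthogonal for the trace form, and satisfy the
three-term recurrence of the numbers `pEntry q a b n i 0, …, pEntry q a b n i n`. -/
structure IsRecurrent {Ω : Type*} [Fintype Ω] [DecidableEq Ω] (q a b : ℝ) (n : ℕ)
    (T : ℕ → Matrix Ω Ω ℝ) : Prop where
  zero : T 0 = 1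
  last : T (n + 1) = 0
  orth : ∀ j k, j ≠ k → (T j * T k).trace = 0
  step : ∀ k, (q - 1) • (T 1 * T (k + 1)) = (q ^ (n + 1) - q ^ (k + 1)) • T k +
    ((a - b) * (q ^ (k + 1) - 1)) • T (k + 1) + (q ^ (k + 2) - 1) • T (k + 2)

/-- The polynomials that express `T k` through `T 1` if `T` is recurrent. -/
def recPoly (q a b : ℝ) (n : ℕ) : ℕ → ℝ[X]
  | 0 => 1
  | 1 => X
  | k + 2 => C (q ^ (k + 2) - 1)⁻¹ * (C (q - 1) * (X * recPoly q a b n (k + 1)) -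
      C (q ^ (n + 1) - q ^ (k + 1)) * recPoly q a b n k -
      C ((a - b) * (q ^ (k + 1) - 1)) * recPoly q a b n (k + 1))

theorem eval_recPoly {q a b : ℝ} (hq : 1 < q) (hab : a * b = q) {n i : ℕ} (hi : i ≤ n) (k : ℕ) :
    (recPoly q a b n k).eval (pEntry q a b n i 1) = pEntry q a b n i k := by
  induction k using Nat.twoStepInduction with
  | zero => simp [recPoly, pEntry_zero]
  | one => simp [recPoly]
  | more k h0 h1 =>
    have hne : q ^ (k + 2) - 1 ≠ 0 := (sub_pos.2 (one_lt_pow_succ hq (k + 1))).ne'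
    simp only [recPoly, eval_mul, eval_sub, eval_C, eval_X, h0, h1]
    rw [inv_mul_eq_iff_eq_mul₀ hne]
    linear_combination pEntry_rec hq hab hi k

theorem degree_recPoly {q : ℝ} (hq : 1 < q) (a b : ℝ) (n k : ℕ) :
    (recPoly q a b n k).degree = (k : WithBot ℕ) := by
  induction k using Nat.twoStepInduction with
  | zero => simp [recPoly]
  | one => simp [recPoly]
  | more k h0 h1 =>
    have hne : q ^ (k + 2) - 1 ≠ 0 := (sub_pos.2 (one_lt_pow_succ hq (k + 1))).ne'
    have h2 : (C (q - 1) * (X * recPoly q a b n (k + 1))).degree = ((k + 2 : ℕ) : WithBot ℕ) := by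
      rw [degree_C_mul (by linarith : q - 1 ≠ 0), degree_mul, degree_X, h1]
      push_cast; ring
    rw [recPoly, degree_C_mul (inv_ne_zero hne), sub_sub, degree_sub_eq_left_of_degree_lt, h2]
    rw [h2]
    refine (degree_add_le _ _).trans_lt (max_lt ?_ ?_)
    · rw [← smul_eq_C_mul]
      refine (degree_smul_le _ _).trans_lt ?_
      rw [h0]; exact_mod_cast (by omega : k < k + 2)
    · rw [← smul_eq_C_mul]
      refine (degree_smul_le _ _).trans_lt ?_
      rw [h1]; exact_mod_cast (by omega : k + 1 < k + 2)

theorem eq_zero_of_forall_eval_pEntry {q a b : ℝ} (hq : 1 < q) (ha : 0 < a) (hb : 0 < b) {n : ℕ}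
    {f : ℝ[X]} (hd : f.degree < ((n + 1 : ℕ) : WithBot ℕ))
    (hf : ∀ i ≤ n, f.eval (pEntry q a b n i 1) = 0) : f = 0 := by
  refine eq_zero_of_degree_lt_of_eval_index_eq_zero (Finset.range (n + 1))
    (pEntry_one_injOn hq ha hb n) ?_ fun i hi => hf i ?_
  · simpa using hd
  · have := Finset.mem_range.1 hi; omega

section

variable {Ω : Type*} [Fintype Ω] [DecidableEq Ω] {q a b : ℝ} {n : ℕ} {T : ℕ → Matrix Ω Ω ℝ}

theorem IsRecurrent.aeval_recPoly (hT : IsRecurrent q a b n T) (hq : 1 < q) (k : ℕ) :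
    aeval (T 1) (recPoly q a b n k) = T k := by
  induction k using Nat.twoStepInduction with
  | zero => simp [recPoly, hT.zero]
  | one => simp [recPoly]
  | more k h0 h1 =>
    have hne : q ^ (k + 2) - 1 ≠ 0 := (sub_pos.2 (one_lt_pow_succ hq (k + 1))).ne'
    simp only [recPoly, ← smul_eq_C_mul, map_smul, aeval_sub, aeval_mul, aeval_X, h0, h1, hT.step]
    rw [add_assoc, add_sub_cancel_left, add_sub_cancel_left, smul_smul, inv_mul_cancel₀ hne,
      one_smul]

/-- The polynomial `recPoly q a b n (n + 1)` kills T 1 because T (n + 1) = 0, and it vanishes at the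
n + 1 distinct eigenvalues. The remainder of f modulo it has degree at most n and the same zeros, so
it is zero. -/
theorem IsRecurrent.aeval_eq_zero (hT : IsRecurrent q a b n T) (hq : 1 < q) (hab : a * b = q)
    (ha : 0 < a) (hb : 0 < b) {f : ℝ[X]} (hf : ∀ i ≤ n, f.eval (pEntry q a b n i 1) = 0) :
    aeval (T 1) f = 0 := by
  set w := recPoly q a b n (n + 1) with hw
  have hwd : w.degree = ((n + 1 : ℕ) : WithBot ℕ) := degree_recPoly hq a b n (n + 1)
  have hw0 : w ≠ 0 := by
    intro h; rw [h, degree_zero] at hwd; exact WithBot.bot_ne_natCast _ hwd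
  have hmod : f % w = 0 := by
    refine eq_zero_of_forall_eval_pEntry hq ha hb (n := n) (hwd ▸ EuclideanDomain.mod_lt f hw0)
      fun i hi => ?_
    have h1 := congrArg (eval (pEntry q a b n i 1)) (EuclideanDomain.div_add_mod f w)
    rw [eval_add, eval_mul, hf i hi, hw, eval_recPoly hq hab hi,
      pEntry_eq_zero_of_lt q a b hi (Nat.lt_succ_self n), zero_mul, zero_add] at h1
    exact h1
  rw [← EuclideanDomain.div_add_mod f w, hmod, add_zero, map_mul, hw, hT.aeval_recPoly hq,
    hT.last, zero_mul]

theorem IsRecurrent.aeval_congr (hT : IsRecurrent q a b n T) (hq : 1 < q) (hab : a * b = q)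
    (ha : 0 < a) (hb : 0 < b) {f g : ℝ[X]}
    (h : ∀ i ≤ n, f.eval (pEntry q a b n i 1) = g.eval (pEntry q a b n i 1)) :
    aeval (T 1) f = aeval (T 1) g := by
  rw [← sub_eq_zero, ← map_sub]
  exact hT.aeval_eq_zero hq hab ha hb fun i hi => by rw [eval_sub, h i hi, sub_self]

/-- The spectral idempotents of a recurrent family. -/
def specIdem (q a b : ℝ) (n : ℕ) (T : ℕ → Matrix Ω Ω ℝ) (i : ℕ) : Matrix Ω Ω ℝ :=
  aeval (T 1) (Lagrange.basis (Finset.range (n + 1)) (fun i => pEntry q a b n i 1) i)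

theorem eval_basis_pEntry (hq : 1 < q) (ha : 0 < a) (hb : 0 < b) {i j : ℕ}
    (hi : i ≤ n) (hj : j ≤ n) :
    (Lagrange.basis (Finset.range (n + 1)) (fun i => pEntry q a b n i 1) i).eval
      (pEntry q a b n j 1) = if i = j then 1 else 0 := by
  split_ifs with h
  · subst h
    have hmem : i ∈ Finset.range (n + 1) := Finset.mem_range.2 (by omega)
    exact Lagrange.eval_basis_self (v := fun i => pEntry q a b n i 1)
      (pEntry_one_injOn hq ha hb n) hmem
  · have hmem : j ∈ Finset.range (n + 1) := Finset.mem_range.2 (by omega)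
    exact Lagrange.eval_basis_of_ne (v := fun i => pEntry q a b n i 1) h hmem

theorem IsRecurrent.specIdem_mul (hT : IsRecurrent q a b n T) (hq : 1 < q) (hab : a * b = q)
    (ha : 0 < a) (hb : 0 < b) {i j : ℕ} (hi : i ≤ n) (hj : j ≤ n) :
    specIdem q a b n T i * specIdem q a b n T j = if i = j then specIdem q a b n T i else 0 := by
  rw [specIdem, specIdem, ← map_mul]
  split_ifs with h
  · subst h
    refine hT.aeval_congr hq hab ha hb fun k hk => ?_
    rw [eval_mul, eval_basis_pEntry hq ha hb hi hk]
    split_ifs <;> simp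
  · refine hT.aeval_eq_zero hq hab ha hb fun k hk => ?_
    rw [eval_mul, eval_basis_pEntry hq ha hb hi hk, eval_basis_pEntry hq ha hb hj hk]
    split_ifs with h1 h2
    · exact absurd (h1.trans h2.symm) h
    all_goals simp

theorem IsRecurrent.eq_sum_specIdem (hT : IsRecurrent q a b n T) (hq : 1 < q) (hab : a * b = q)
    (ha : 0 < a) (hb : 0 < b) (k : ℕ) :
    T k = ∑ i ∈ Finset.range (n + 1), pEntry q a b n i k • specIdem q a b n T i := by
  simp only [specIdem]
  rw [← hT.aeval_recPoly hq k]
  simp only [← map_smul, ← map_sum]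
  refine hT.aeval_congr hq hab ha hb fun i hi => ?_
  rw [eval_recPoly hq hab hi, eval_finsetSum, Finset.sum_eq_single_of_mem i
    (Finset.mem_range.2 (by omega))]
  · rw [eval_smul, eval_basis_pEntry hq ha hb hi hi, if_pos rfl, smul_eq_mul, mul_one]
  · intro j hj hne
    rw [eval_smul, eval_basis_pEntry hq ha hb (by have := Finset.mem_range.1 hj; omega) hi,
      if_neg hne, smul_zero]

/-- The trace of T_1 T_(k+1) T_k is expanded in two ways: by the recurrence for T_1 T_(k+1), and by
the one for T_1 T_k. Orthogonality leaves one term each time. -/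
theorem IsRecurrent.trace_step (hT : IsRecurrent q a b n T) (hq : 1 < q) (k : ℕ) :
    (q ^ (k + 1) - 1) * (T (k + 1) * T (k + 1)).trace =
      (q ^ (n + 1) - q ^ (k + 1)) * (T k * T k).trace := by
  have h1 : (q - 1) * (T 1 * T (k + 1) * T k).trace =
      (q ^ (n + 1) - q ^ (k + 1)) * (T k * T k).trace := by
    have h := congrArg (fun M => (M * T k).trace) (hT.step k)
    simpa [add_mul, Matrix.trace_add, Matrix.trace_smul, hT.orth (k + 1) k (by omega),
      hT.orth (k + 2) k (by omega)] using h
  rw [← h1]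
  rcases k with _ | k
  · have h := congrArg Matrix.trace (hT.step 0)
    simp [hT.zero]
  · have h := congrArg (fun M => (M * T (k + 2)).trace) (hT.step k)
    -- All members of the family commute, being polynomials in T 1.
    have h2 : (T 1 * T (k + 1) * T (k + 2)).trace = (T 1 * T (k + 2) * T (k + 1)).trace := by
      rw [mul_assoc, mul_assoc, ← hT.aeval_recPoly hq (k + 1), ← hT.aeval_recPoly hq (k + 2),
        ← map_mul, ← map_mul, mul_comm]
    rw [← h2]
    simpa [add_mul, Matrix.trace_add, Matrix.trace_smul, hT.orth k (k + 2) (by omega),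
      hT.orth (k + 1) (k + 2) (by omega)] using h.symm

/-- The norms for the trace form depend on neither a nor b: they are the number of points times the
valencies. Their positivity for k ≤ n gives linear independence, and later the existence of
generators at each distance. -/
theorem IsRecurrent.trace_sq (hT : IsRecurrent q a b n T) (hq : 1 < q) (k : ℕ) :
    (T k * T k).trace = Fintype.card Ω * (q ^ k * q ^ k.choose 2 * gauss q n k) := by
  induction k with
  | zero => simp [hT.zero, gauss_zero_right]
  | succ k ih =>
    have hne : q ^ (k + 1) - 1 ≠ 0 := (sub_pos.2 (one_lt_pow_succ hq k)).ne'
    have h := hT.trace_step hq k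
    have hkey : (q ^ (n + 1) - q ^ (k + 1)) * gauss q n k =
        q ^ (k + 1) * (q ^ (n - k) - 1) * gauss q n k := by
      rcases le_or_gt k n with hkn | hkn
      · obtain ⟨s, rfl⟩ := Nat.exists_eq_add_of_le hkn
        rw [Nat.add_sub_cancel_left]; ring
      · rw [gauss_eq_zero_of_lt q hkn]; ring
    rw [← mul_right_inj' hne, h, ih, gauss_succ_right, Nat.choose_succ_succ' k 1,
      Nat.choose_one_right]
    field_simp
    linear_combination (Fintype.card Ω : ℝ) * q ^ k * q ^ k.choose 2 * hkey

theorem IsRecurrent.linearIndependent [Nonempty Ω] (hT : IsRecurrent q a b n T) (hq : 1 < q) :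
    LinearIndependent ℝ fun k : Fin (n + 1) => T k := by
  rw [Fintype.linearIndependent_iff]
  intro g hg k
  have h := congrArg (fun M => (M * T k).trace) hg
  simp only [Finset.sum_mul, Matrix.trace_sum, smul_mul_assoc, Matrix.trace_smul, zero_mul,
    Matrix.trace_zero] at h
  rw [Finset.sum_eq_single k (fun j _ hj => by
    rw [hT.orth j k (fun h => hj (Fin.ext h)), smul_zero]) (by simp), hT.trace_sq hq] at h
  have := gauss_pos hq (Nat.lt_succ_iff.1 k.2)
  have hc : (0 : ℝ) < Fintype.card Ω := by exact_mod_cast Fintype.card_pos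
  have hq0 : 0 < q := by linarith
  rw [smul_eq_mul] at h
  exact (mul_eq_zero.1 h).resolve_right (by positivity)

theorem IsRecurrent.trace_specIdem_mul (hT : IsRecurrent q a b n T) (hq : 1 < q)
    (hab : a * b = q) (ha : 0 < a) (hb : 0 < b) {i : ℕ} (hi : i ≤ n) (k : ℕ) :
    (specIdem q a b n T i * T k).trace =
      pEntry q a b n i k * (specIdem q a b n T i).trace := by
  rw [hT.eq_sum_specIdem hq hab ha hb k, Finset.mul_sum, Finset.sum_eq_single_of_mem i
    (Finset.mem_range.2 (Nat.lt_succ_of_le hi))]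
  · rw [mul_smul_comm, hT.specIdem_mul hq hab ha hb hi hi, if_pos rfl, Matrix.trace_smul,
      smul_eq_mul]
  · intro j hj hne
    rw [mul_smul_comm, hT.specIdem_mul hq hab ha hb hi
      (Nat.lt_succ_iff.1 (Finset.mem_range.1 hj)), if_neg hne.symm, smul_zero]

/-- The n + 1 independent matrices T k are combinations of the n + 1 spectral idempotents, so the
latter are independent and span the same space. -/
theorem IsRecurrent.specIdem_ne_zero_and_mem [Nonempty Ω] (hT : IsRecurrent q a b n T)
    (hq : 1 < q) (hab : a * b = q) (ha : 0 < a) (hb : 0 < b) {i : ℕ} (hi : i ≤ n) :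
    specIdem q a b n T i ≠ 0 ∧
      specIdem q a b n T i ∈ Submodule.span ℝ (Set.range fun k : Fin (n + 1) => T k) := by
  have hsum : ∀ j : Fin (n + 1), T j =
      ∑ i : Fin (n + 1), pEntry q a b n i j • specIdem q a b n T i := by
    intro j
    rw [hT.eq_sum_specIdem hq hab ha hb, Finset.sum_range]
  have hli := linearIndependent_and_span_eq_of_eq_sum
    (A := fun k : Fin (n + 1) => T k) (E := fun i : Fin (n + 1) => specIdem q a b n T i)
    (P := fun i j : Fin (n + 1) => pEntry q a b n i j) (hT.linearIndependent hq) hsum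
  refine ⟨hli.1.ne_zero (⟨i, Nat.lt_succ_of_le hi⟩ : Fin (n + 1)), ?_⟩
  rw [hli.2]
  exact Submodule.subset_span (Set.mem_range_self (⟨i, Nat.lt_succ_of_le hi⟩ : Fin (n + 1)))

/-- The spectral idempotents of a recurrent family in terms of the family. -/
theorem IsRecurrent.specIdem_eq [Nonempty Ω] (hT : IsRecurrent q a b n T) (hq : 1 < q)
    (hab : a * b = q) (ha : 0 < a) (hb : 0 < b) {i : ℕ} (hi : i ≤ n) :
    ∃ c : ℝ, c ≠ 0 ∧ specIdem q a b n T i = ∑ k ∈ Finset.range (n + 1),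
      (c * (b ^ k)⁻¹ * (dualPoly q a b n i).eval (q ^ k)⁻¹) • T k := by
  obtain ⟨hE0, hmem⟩ := hT.specIdem_ne_zero_and_mem hq hab ha hb hi
  have htr := hT.trace_specIdem_mul hq hab ha hb hi
  generalize specIdem q a b n T i = E at hE0 hmem htr ⊢
  obtain ⟨c, hc⟩ := (Submodule.mem_span_range_iff_exists_fun ℝ).1 hmem
  have hcard : (0 : ℝ) < Fintype.card Ω := by exact_mod_cast Fintype.card_pos
  have hq0 : 0 < q := by linarith
  have hgi := gauss_pos hq hi
  -- By orthogonality c k is tr(E T_k) / tr(T_k²). The numerator is the eigenvalue times tr E; the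
  -- duality turns it into a^k times the dual polynomial, and a^k / q^k = b^(-k).
  have hck : ∀ k : Fin (n + 1), c k = E.trace / (Fintype.card Ω * gauss q n i) *
      (b ^ (k : ℕ))⁻¹ * (dualPoly q a b n i).eval (q ^ (k : ℕ))⁻¹ := by
    intro k
    have hk : (k : ℕ) ≤ n := Nat.lt_succ_iff.1 k.2
    have h1 := htr k
    have h2 : (E * T k).trace = c k * (T k * T k).trace := by
      rw [← hc]
      simp only [Finset.sum_mul, Matrix.trace_sum, smul_mul_assoc, Matrix.trace_smul]
      rw [Finset.sum_eq_single k (fun j _ hj => by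
        rw [hT.orth j k (fun h => hj (Fin.ext h)), smul_zero]) (by simp), smul_eq_mul]
    have hgk := gauss_pos hq hk
    have h3 := pEntry_eq_dualPoly (b := b) hq ha hi hk
    rw [h2, hT.trace_sq hq] at h1
    generalize (k : ℕ) = m at *
    generalize (dualPoly q a b n i).eval (q ^ m)⁻¹ = D at *
    have h4 : q ^ m = a ^ m * b ^ m := by rw [← hab, mul_pow]
    have h5 : (0 : ℝ) < a ^ m * q ^ m.choose 2 * gauss q n m := by positivity
    have h6 : (0 : ℝ) < Fintype.card Ω * gauss q n i * b ^ m := by positivity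
    have h7 : c k * (Fintype.card Ω * gauss q n i * b ^ m) = E.trace * D := by
      rw [← mul_left_inj' h5.ne']
      rw [h4] at h1
      linear_combination gauss q n i * h1 + E.trace * h3
    rw [← mul_left_inj' h6.ne', h7]
    field_simp
  refine ⟨E.trace / (Fintype.card Ω * gauss q n i), fun h0 => hE0 ?_, ?_⟩
  · rw [← hc]
    refine Finset.sum_eq_zero fun k _ => ?_
    rw [hck, h0, zero_mul, zero_mul, zero_smul]
  · rw [Finset.sum_range, ← hc]
    refine Finset.sum_congr rfl fun k _ => ?_
    rw [hck, hc]

end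

/-! ### Geometry of the generators -/

section Geometry

variable {F : Type*} [Field F] {V : Type*} [AddCommGroup V] [Module F V]

/-- `B` is a symplectic form on a space of dimension `2n`. -/
structure IsSymplectic (B : LinearMap.BilinForm F V) (n : ℕ) : Prop where
  alt : B.IsAlt
  nondeg : B.Nondegenerate
  dim : finrank F V = 2 * n

variable {B : LinearMap.BilinForm F V} {n : ℕ}

theorem Generator.mem_iff (X : Generator B) {v : V} : v ∈ X.1 ↔ ∀ x ∈ X.1, B x v = 0 := by
  rw [← LinearMap.BilinForm.mem_orthogonal_iff, X.2]

theorem Generator.form_eq_zero (X : Generator B) {v w : V} (hv : v ∈ X.1) (hw : w ∈ X.1) :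
    B v w = 0 :=
  X.mem_iff.1 hw v hv

theorem IsSymplectic.eq_neg (hB : IsSymplectic B n) (v w : V) : B v w = -B w v :=
  (hB.alt.neg_eq w v).symm

theorem IsSymplectic.eq_zero_comm (hB : IsSymplectic B n) {v w : V} : B v w = 0 ↔ B w v = 0 := by
  rw [hB.eq_neg v w, neg_eq_zero]

/-- The hyperplane of `X` orthogonal to `v`. -/
def hyperplane (X : Generator B) (v : V) : Submodule F V := X.1 ⊓ LinearMap.ker (B v)

theorem IsSymplectic.mem_hyperplane (hB : IsSymplectic B n) {X : Generator B} {v w : V} :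
    w ∈ hyperplane X v ↔ w ∈ X.1 ∧ B w v = 0 := by
  rw [hyperplane, Submodule.mem_inf, LinearMap.mem_ker, hB.eq_zero_comm]

variable [FiniteDimensional F V]

theorem IsSymplectic.finrank_generator (hB : IsSymplectic B n) (X : Generator B) :
    finrank F X.1 = n := by
  have h := LinearMap.BilinForm.finrank_orthogonal hB.nondeg X.1
  have h2 := Submodule.finrank_le X.1
  rw [X.2, hB.dim] at h
  rw [hB.dim] at h2
  omega

/-- A maximal totally isotropic subspace works: a vector orthogonal to it but outside it could be
adjoined, the form being alternating. -/
theorem IsSymplectic.nonempty_generator (hB : IsSymplectic B n) : Nonempty (Generator B) := by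
  let S : Set (Submodule F V) := {X | X ≤ B.orthogonal X}
  have hS : (⊥ : Submodule F V) ∈ S := Set.mem_ofPred.2 bot_le
  obtain ⟨X, hX, hmax⟩ := WellFounded.has_min
    (wellFounded_gt (α := Submodule F V)) S ⟨_, hS⟩
  refine ⟨⟨X, le_antisymm (fun v hv => ?_) hX⟩⟩
  by_contra hvX
  rw [LinearMap.BilinForm.mem_orthogonal_iff] at hv
  refine hmax (X ⊔ Submodule.span F {v}) (fun w hw => ?_) ?_
  · rw [LinearMap.BilinForm.mem_orthogonal_iff]
    intro u hu
    obtain ⟨x, hx, _, h1, rfl⟩ := Submodule.mem_sup.1 hw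
    obtain ⟨y, hy, _, h2, rfl⟩ := Submodule.mem_sup.1 hu
    obtain ⟨s, rfl⟩ := Submodule.mem_span_singleton.1 h1
    obtain ⟨t, rfl⟩ := Submodule.mem_span_singleton.1 h2
    have h3 : B y x = 0 := hX hx y hy
    have h4 : B y v = 0 := hv y hy
    have h5 : B v x = 0 := hB.eq_zero_comm.1 (hv x hx)
    have h6 : B v v = 0 := hB.alt v
    simp [h3, h4, h5, h6]
  · refine lt_of_le_of_ne le_sup_left fun h => hvX ?_
    rw [h]
    exact Submodule.mem_sup_right (Submodule.mem_span_singleton_self v)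

theorem IsSymplectic.genDist_add_finrank (hB : IsSymplectic B n) (X Y : Generator B) :
    genDist X Y + finrank F (X.1 ⊓ Y.1 : Submodule F V) = n := by
  have h : finrank F (X.1 ⊓ Y.1 : Submodule F V) ≤ finrank F X.1 :=
    Submodule.finrank_mono inf_le_left
  rw [genDist, Nat.sub_add_cancel h, hB.finrank_generator]

theorem IsSymplectic.genDist_le (hB : IsSymplectic B n) (X Y : Generator B) : genDist X Y ≤ n := by
  have := hB.genDist_add_finrank X Y
  omega

theorem IsSymplectic.genDist_comm (hB : IsSymplectic B n) (X Y : Generator B) :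
    genDist X Y = genDist Y X := by
  have h1 := hB.genDist_add_finrank X Y
  have h2 := hB.genDist_add_finrank Y X
  rw [inf_comm] at h2
  omega

theorem IsSymplectic.genDist_eq_zero (hB : IsSymplectic B n) {X Y : Generator B} :
    genDist X Y = 0 ↔ X = Y := by
  have h1 := hB.genDist_add_finrank X Y
  constructor
  · intro h
    have hX := Submodule.eq_of_le_of_finrank_le (inf_le_left : X.1 ⊓ Y.1 ≤ X.1)
      (by rw [hB.finrank_generator]; omega)
    have hY := Submodule.eq_of_le_of_finrank_le (inf_le_right : X.1 ⊓ Y.1 ≤ Y.1)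
      (by rw [hB.finrank_generator]; omega)
    exact Subtype.ext (hX.symm.trans hY)
  · rintro rfl
    rw [inf_idem, hB.finrank_generator] at h1
    omega

theorem IsSymplectic.orthogonal_inf (hB : IsSymplectic B n) (X Y : Generator B) :
    B.orthogonal (X.1 ⊓ Y.1) = X.1 ⊔ Y.1 := by
  have h : B.orthogonal (X.1 ⊔ Y.1) = X.1 ⊓ Y.1 := by
    refine le_antisymm (le_inf ?_ ?_) fun v hv => ?_
    · exact (LinearMap.BilinForm.orthogonal_le le_sup_left).trans X.2.le
    · exact (LinearMap.BilinForm.orthogonal_le le_sup_right).trans Y.2.le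
    · rw [LinearMap.BilinForm.mem_orthogonal_iff]
      intro u hu
      obtain ⟨x, hx, y, hy, rfl⟩ := Submodule.mem_sup.1 hu
      rw [map_add, LinearMap.add_apply, X.form_eq_zero hx hv.1, Y.form_eq_zero hy hv.2, add_zero]
  rw [← h, LinearMap.BilinForm.orthogonal_orthogonal hB.nondeg hB.alt.isRefl]

theorem IsSymplectic.mem_sup_iff (hB : IsSymplectic B n) {X Y : Generator B} {v : V} :
    v ∈ X.1 ⊔ Y.1 ↔ ∀ u ∈ X.1 ⊓ Y.1, B u v = 0 := by
  rw [← hB.orthogonal_inf, LinearMap.BilinForm.mem_orthogonal_iff]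

theorem IsSymplectic.finrank_sup (hB : IsSymplectic B n) (X Y : Generator B) :
    finrank F (X.1 ⊔ Y.1 : Submodule F V) = n + genDist X Y := by
  have h1 := Submodule.finrank_sup_add_finrank_inf_eq X.1 Y.1
  have h2 := hB.genDist_add_finrank X Y
  rw [hB.finrank_generator, hB.finrank_generator] at h1
  omega

theorem IsSymplectic.finrank_hyperplane (hB : IsSymplectic B n) {X : Generator B} {v : V}
    (hv : v ∉ X.1) : finrank F (hyperplane X v) + 1 = n := by
  set f : X.1 →ₗ[F] F := (B v).comp X.1.subtype with hf
  have hf0 : f ≠ 0 := by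
    intro h
    refine hv (X.mem_iff.2 fun x hx => ?_)
    rw [hB.eq_zero_comm]
    exact congrArg (fun g : X.1 →ₗ[F] F => g ⟨x, hx⟩) h
  have h1 := Module.Dual.finrank_ker_add_one_of_ne_zero (f := f) hf0
  rw [hB.finrank_generator] at h1
  rw [← h1]
  congr 1
  have h2 : hyperplane X v = (LinearMap.ker f).map X.1.subtype := by
    ext w
    simp [hyperplane, hf, and_comm]
  rw [h2, Submodule.finrank_map_subtype_eq]

theorem IsSymplectic.finrank_hyperplane_sup (hB : IsSymplectic B n) {X : Generator B} {v : V}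
    (hv : v ∉ X.1) : finrank F (hyperplane X v ⊔ Submodule.span F {v} : Submodule F V) = n := by
  have h1 := Submodule.finrank_sup_add_finrank_inf_eq (hyperplane X v) (Submodule.span F {v})
  have h2 : hyperplane X v ⊓ Submodule.span F {v} = ⊥ := by
    rw [← disjoint_iff, Submodule.disjoint_span_singleton]
    exact fun h => absurd h.1 hv
  have h3 : finrank F (Submodule.span F {v}) = 1 :=
    finrank_span_singleton (fun h => hv (h ▸ X.1.zero_mem))
  have h4 := hB.finrank_hyperplane hv
  rw [h2, h3, finrank_bot] at h1
  omega

/-- A neighbour `Z` of `X` meets `X` in the hyperplane orthogonal to any vector of `Z` outside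
`X`. -/
theorem IsSymplectic.inf_eq_hyperplane (hB : IsSymplectic B n) {X Z : Generator B} {v : V}
    (hv : v ∉ X.1) (hvZ : v ∈ Z.1) (hd : genDist X Z = 1) : X.1 ⊓ Z.1 = hyperplane X v := by
  have h1 := hB.genDist_add_finrank X Z
  have h2 := hB.finrank_hyperplane hv
  refine Submodule.eq_of_le_of_finrank_le (fun w hw => ?_) (by omega)
  exact hB.mem_hyperplane.2 ⟨hw.1, Z.form_eq_zero hw.2 hvZ⟩

/-- The only candidate is (X ∩ v^⊥) + ⟨v⟩, which is isotropic of dimension n. This lets neighbours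
be counted through vectors. -/
theorem IsSymplectic.existsUnique_neighbour (hB : IsSymplectic B n) {X : Generator B} {v : V}
    (hv : v ∉ X.1) : ∃! Z : Generator B, genDist X Z = 1 ∧ v ∈ Z.1 := by
  have hfin := hB.finrank_hyperplane_sup hv
  set W := (hyperplane X v ⊔ Submodule.span F {v} : Submodule F V) with hW
  have hvW : v ∈ W := Submodule.mem_sup_right (Submodule.mem_span_singleton_self v)
  have hiso : W ≤ B.orthogonal W := by
    intro w hw
    rw [LinearMap.BilinForm.mem_orthogonal_iff]
    intro u hu
    obtain ⟨x, hx, _, h1, rfl⟩ := Submodule.mem_sup.1 hw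
    obtain ⟨y, hy, _, h2, rfl⟩ := Submodule.mem_sup.1 hu
    obtain ⟨s, rfl⟩ := Submodule.mem_span_singleton.1 h1
    obtain ⟨t, rfl⟩ := Submodule.mem_span_singleton.1 h2
    rw [hB.mem_hyperplane] at hx hy
    have h3 : B y x = 0 := X.form_eq_zero hy.1 hx.1
    have h4 : B y v = 0 := hy.2
    have h5 : B v x = 0 := hB.eq_zero_comm.1 hx.2
    have h6 : B v v = 0 := hB.alt v
    simp [h3, h4, h5, h6]
  have hgen : B.orthogonal W = W := by
    refine (Submodule.eq_of_le_of_finrank_le hiso ?_).symm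
    rw [LinearMap.BilinForm.finrank_orthogonal hB.nondeg, hfin, hB.dim]
    omega
  refine ⟨⟨W, hgen⟩, ⟨?_, hvW⟩, ?_⟩
  · have h1 := hB.genDist_add_finrank X ⟨W, hgen⟩
    have h2 := hB.finrank_hyperplane hv
    have h3 : hyperplane X v ≤ X.1 ⊓ W := le_inf inf_le_left le_sup_left
    have h4 := Submodule.finrank_mono h3
    have h5 : genDist X ⟨W, hgen⟩ ≠ 0 := by
      rw [Ne, hB.genDist_eq_zero]
      intro h
      have hXW : X.1 = W := congrArg Subtype.val h
      exact hv (hXW ▸ hvW)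
    dsimp only at h1
    omega
  · rintro Z ⟨hd, hvZ⟩
    refine Subtype.ext (Submodule.eq_of_le_of_finrank_le ?_ ?_).symm
    · refine sup_le ?_ ?_
      · rw [← hB.inf_eq_hyperplane hv hvZ hd]; exact inf_le_right
      · rwa [Submodule.span_singleton_le_iff_mem]
    · rw [hB.finrank_generator]; exact hfin.ge

/-- A basis of a submodule extends to a basis of a larger one. -/
theorem exists_basis_extending {k m N : ℕ} (h : k + m = N) {U X : Submodule F V} (hUX : U ≤ X)
    (hX : finrank F X = N) (u : Basis (Fin m) F U) :
    ∃ x : Basis (Fin N) F X, ∀ i : Fin m, (x (Fin.cast h (Fin.natAdd k i)) : V) = u i := by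
  cases h
  obtain ⟨C, hC⟩ := Submodule.exists_isCompl (U.comap X.subtype)
  have hU : finrank F U = m := by rw [finrank_eq_card_basis u, Fintype.card_fin]
  have hU' : finrank F (U.comap X.subtype) = m := by
    rw [← hU]; exact (Submodule.comapSubtypeEquivOfLe hUX).finrank_eq
  have hCk : finrank F C = k := by
    have := Submodule.finrank_add_eq_of_isCompl hC
    omega
  refine ⟨(((finBasisOfFinrankEq F C hCk).prod
    (u.map (Submodule.comapSubtypeEquivOfLe hUX).symm)).map
      (Submodule.prodEquivOfIsCompl C _ hC.symm)).reindex finSumFinEquiv, fun i => ?_⟩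
  simp

theorem IsSymplectic.exists_isAdapted (hB : IsSymplectic B n) (X Y : Generator B) :
    ∃ (x : Basis (Fin n) F X.1) (y : Basis (Fin n) F Y.1), IsAdapted x y := by
  have h := hB.genDist_add_finrank X Y
  let u := finBasis F (X.1 ⊓ Y.1 : Submodule F V)
  obtain ⟨x, hx⟩ := exists_basis_extending h inf_le_left (hB.finrank_generator X) u
  obtain ⟨y, hy⟩ := exists_basis_extending h inf_le_right (hB.finrank_generator Y) u
  refine ⟨x, y, fun i hi => ?_⟩
  have h1 : (i : ℕ) - genDist X Y < finrank F (X.1 ⊓ Y.1 : Submodule F V) := by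
    have := i.2; omega
  have h2 : i = Fin.cast h (Fin.natAdd (genDist X Y) ⟨(i : ℕ) - genDist X Y, h1⟩) := by
    ext; simp; omega
  rw [h2, hx, hy]

end Geometry

/-! ### Gram determinants of adapted bases -/

section Mask

variable {F : Type*} [Field F] {n : ℕ} (p : Fin n → Prop) [DecidablePred p]

/-- The matrix that agrees with `M` on the rows and columns in `p`, and with the identity
elsewhere. -/
def mask (M : Matrix (Fin n) (Fin n) F) : Matrix (Fin n) (Fin n) F :=
  Matrix.of fun i j => if p i then if p j then M i j else 0 else if i = j then 1 else 0

variable {p}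

theorem mask_of_pos {M : Matrix (Fin n) (Fin n) F} {i j : Fin n} (hi : p i) (hj : p j) :
    mask p M i j = M i j := by simp [mask, hi, hj]

theorem mask_of_neg_left {M : Matrix (Fin n) (Fin n) F} {i j : Fin n} (hi : ¬p i) :
    mask p M i j = if i = j then 1 else 0 := by simp [mask, hi]

theorem mask_of_neg_right {M : Matrix (Fin n) (Fin n) F} {i j : Fin n} (hj : ¬p j) :
    mask p M i j = if i = j then 1 else 0 := by
  by_cases hi : p i
  · have : i ≠ j := by rintro rfl; exact hj hi
    simp [mask, hi, hj, this]
  · exact mask_of_neg_left hi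

/-- The masked matrix is block diagonal with an identity block. Minors on different index sets
thereby become determinants of one common size. -/
theorem det_mask (M : Matrix (Fin n) (Fin n) F) :
    (mask p M).det = (M.toSquareBlockProp p).det := by
  rw [Matrix.twoBlockTriangular_det' _ p fun i hi j hj => ?_]
  · have h1 : (mask p M).toSquareBlockProp p = M.toSquareBlockProp p := by
      ext i j
      exact mask_of_pos i.2 j.2
    have h2 : (mask p M).toSquareBlockProp (fun i => ¬p i) = 1 := by
      ext i j
      simp [Matrix.toSquareBlockProp, mask_of_neg_left i.2, Matrix.one_apply, Subtype.ext_iff]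
    rw [h1, h2, Matrix.det_one, mul_one]
  · rw [mask_of_neg_right hj, if_neg (by rintro rfl; exact hj hi)]

theorem det_mask_mul_det_mask {M : Matrix (Fin n) (Fin n) F}
    (h : ∀ i, p i → ∀ j, ¬p j → M i j = 0) :
    M.det = (mask p M).det * (mask (fun i => ¬p i) M).det := by
  rw [Matrix.twoBlockTriangular_det' M p h, det_mask, det_mask]

theorem mask_mul {A C : Matrix (Fin n) (Fin n) F}
    (h : ∀ i j k, p i → p j → ¬p k → A i k * C k j = 0) :
    mask p (A * C) = mask p A * mask p C := by
  ext i j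
  rw [Matrix.mul_apply]
  by_cases hi : p i
  · by_cases hj : p j
    · rw [mask_of_pos hi hj, Matrix.mul_apply]
      refine Finset.sum_congr rfl fun k _ => ?_
      by_cases hk : p k
      · rw [mask_of_pos hi hk, mask_of_pos hk hj]
      · rw [h i j k hi hj hk, mask_of_neg_right hk, if_neg (by rintro rfl; exact hk hi), zero_mul]
    · simp [mask_of_neg_right hj]
  · simp [mask_of_neg_left hi]

theorem mask_transpose (M : Matrix (Fin n) (Fin n) F) :
    mask p M.transpose = (mask p M).transpose := by
  ext i j
  rw [Matrix.transpose_apply]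
  by_cases hi : p i
  · by_cases hj : p j
    · rw [mask_of_pos hi hj, mask_of_pos hj hi, Matrix.transpose_apply]
    · rw [mask_of_neg_right hj, mask_of_neg_left hj]
      exact if_congr eq_comm rfl rfl
  · rw [mask_of_neg_right hi, mask_of_neg_left hi]
    exact if_congr eq_comm rfl rfl

end Mask

/-! ### Bases adapted on an arbitrary index set. -/

section Adapted

variable {F : Type*} [Field F] {V : Type*} [AddCommGroup V] [Module F V]
  {B : LinearMap.BilinForm F V} {n : ℕ}

/-- The matrix of the values of `B` on two families of vectors. -/
def formMatrix (B : LinearMap.BilinForm F V) (x y : Fin n → V) : Matrix (Fin n) (Fin n) F :=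
  Matrix.of fun i j => B (x i) (y j)

/-- Bases of two generators that agree outside the index set `p`, with nonzero Gram determinant on
`p`. -/
structure AdaptedOn (p : Fin n → Prop) [DecidablePred p] {X Y : Generator B}
    (x : Basis (Fin n) F X.1) (y : Basis (Fin n) F Y.1) : Prop where
  eq : ∀ i, ¬p i → (x i : V) = y i
  ne_zero : (mask p (formMatrix B (fun i => (x i : V)) fun i => (y i : V))).det ≠ 0

variable {X Y : Generator B} {p : Fin n → Prop} [DecidablePred p]

theorem coe_eq_sum_repr (x : Basis (Fin n) F X.1) (w : X.1) :
    (w : V) = ∑ k, x.repr w k • (x k : V) := by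
  have h := congrArg Subtype.val (x.sum_repr w)
  rw [← h]
  simp only [Submodule.coe_sum, Submodule.coe_smul]

theorem form_eq_zero_of_eq {x : Basis (Fin n) F X.1} {y : Basis (Fin n) F Y.1}
    (h : ∀ i, ¬p i → (x i : V) = y i) {i j : Fin n} (hij : ¬p i ∨ ¬p j) :
    B (x i : V) (y j : V) = 0 := by
  rcases hij with hi | hj
  · rw [h i hi]; exact Y.form_eq_zero (y i).2 (y j).2
  · rw [← h j hj]; exact X.form_eq_zero (x i).2 (x j).2

/-- As w is orthogonal to every y j, its coordinates in p lie in the left kernel of the nonsingular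
Gram matrix on p. -/
theorem AdaptedOn.repr_eq_zero {x : Basis (Fin n) F X.1} {y : Basis (Fin n) F Y.1}
    (h : AdaptedOn p x y) {w : X.1} (hw : (w : V) ∈ Y.1) {i : Fin n} (hi : p i) :
    x.repr w i = 0 := by
  have h0 : (fun k => if p k then x.repr w k else 0) = 0 := by
    refine Matrix.eq_zero_of_vecMul_eq_zero h.ne_zero (funext fun j => ?_)
    rw [Matrix.vecMul, dotProduct, Pi.zero_apply]
    by_cases hj : p j
    · have h1 : B (w : V) (y j : V) = 0 := Y.form_eq_zero hw (y j).2
      rw [coe_eq_sum_repr x w, map_sum, LinearMap.sum_apply] at h1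
      refine Eq.trans (Finset.sum_congr rfl fun k _ => ?_) h1
      by_cases hk : p k
      · rw [if_pos hk, mask_of_pos hk hj, map_smul]; rfl
      · rw [if_neg hk, zero_mul, map_smul, LinearMap.smul_apply,
          form_eq_zero_of_eq h.eq (Or.inl hk), smul_zero]
    · refine Finset.sum_eq_zero fun k _ => ?_
      rw [mask_of_neg_right hj]
      split_ifs with h1 h2
      · subst h2; exact absurd h1 hj
      all_goals simp
  have := congrFun h0 i
  simpa [hi] using this

/-- The span of the members of a basis outside `p`. -/
def spanOutside (p : Fin n → Prop) (x : Basis (Fin n) F X.1) : Submodule F V :=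
  Submodule.span F (Set.range fun i : {i // ¬p i} => (x i : V))

theorem finrank_spanOutside (x : Basis (Fin n) F X.1) :
    finrank F (spanOutside p x) + Fintype.card {i // p i} = n := by
  have hli : LinearIndependent F (fun i : {i // ¬p i} => (x i : V)) :=
    (x.linearIndependent.map' X.1.subtype (Submodule.ker_subtype _)).comp _
      Subtype.val_injective
  rw [spanOutside, finrank_span_eq_card hli, Fintype.card_subtype_compl, Fintype.card_fin]
  have := Fintype.card_subtype_le p
  rw [Fintype.card_fin] at this
  omega

theorem spanOutside_le {x : Basis (Fin n) F X.1} {y : Basis (Fin n) F Y.1}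
    (h : ∀ i, ¬p i → (x i : V) = y i) : spanOutside p x ≤ X.1 ⊓ Y.1 := by
  rw [spanOutside, Submodule.span_le]
  rintro _ ⟨i, rfl⟩
  exact ⟨(x i).2, by change (x i : V) ∈ Y.1; rw [h i i.2]; exact (y i).2⟩

variable [FiniteDimensional F V]

theorem AdaptedOn.card_eq (hB : IsSymplectic B n) {x : Basis (Fin n) F X.1}
    {y : Basis (Fin n) F Y.1} (h : AdaptedOn p x y) : Fintype.card {i // p i} = genDist X Y := by
  have h1 : X.1 ⊓ Y.1 = spanOutside p x := by
    refine le_antisymm (fun w hw => ?_) (spanOutside_le h.eq)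
    have hsum : w = _ := coe_eq_sum_repr x ⟨w, hw.1⟩
    rw [hsum]
    refine Submodule.sum_mem _ fun k _ => ?_
    by_cases hk : p k
    · rw [h.repr_eq_zero (w := ⟨w, hw.1⟩) hw.2 hk, zero_smul]; exact Submodule.zero_mem _
    · exact Submodule.smul_mem _ _ (Submodule.subset_span ⟨⟨k, hk⟩, rfl⟩)
  have h2 := hB.genDist_add_finrank X Y
  have h3 := finrank_spanOutside (p := p) x
  rw [h1] at h2
  omega

/-- By dimension, the vectors outside p span X ∩ Y. A left kernel vector of the masked Gram matrix
is supported on p and gives a vector of X orthogonal to Y, hence in X ∩ Y; so it is zero. -/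
theorem adaptedOn_of_card_eq (hB : IsSymplectic B n) {x : Basis (Fin n) F X.1}
    {y : Basis (Fin n) F Y.1} (h : ∀ i, ¬p i → (x i : V) = y i)
    (hcard : Fintype.card {i // p i} = genDist X Y) : AdaptedOn p x y := by
  refine ⟨h, fun hdet => ?_⟩
  have h1 : X.1 ⊓ Y.1 = spanOutside p x := by
    have h2 := hB.genDist_add_finrank X Y
    have h3 := finrank_spanOutside (p := p) x
    exact (Submodule.eq_of_le_of_finrank_le (spanOutside_le h) (by omega)).symm
  obtain ⟨v, hv, hv0⟩ := Matrix.exists_vecMul_eq_zero_iff.2 hdet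
  have hvp : ∀ j, ¬p j → v j = 0 := by
    intro j hj
    have := congrFun hv0 j
    simpa [Matrix.vecMul, dotProduct, mask_of_neg_right hj] using this
  let w : X.1 := ∑ k, v k • x k
  have hwv : ∀ k, x.repr w k = v k := fun k => by
    simp only [w]
    rw [x.repr_sum_self]
  have hwY : (w : V) ∈ Y.1 := by
    rw [Y.mem_iff]
    have hwy : ∀ j, B (y j : V) (w : V) = 0 := by
      intro j
      rw [hB.eq_zero_comm, coe_eq_sum_repr x w, map_sum, LinearMap.sum_apply]
      by_cases hj : p j
      · have h2 := congrFun hv0 j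
        rw [Matrix.vecMul, dotProduct, Pi.zero_apply] at h2
        refine Eq.trans (Finset.sum_congr rfl fun k _ => ?_) h2
        rw [hwv, map_smul]
        by_cases hk : p k
        · rw [mask_of_pos hk hj]; rfl
        · rw [hvp k hk]; simp
      · refine Finset.sum_eq_zero fun k _ => ?_
        rw [map_smul, LinearMap.smul_apply, form_eq_zero_of_eq h (Or.inr hj), smul_zero]
    intro u hu
    have hsum : u = _ := coe_eq_sum_repr y ⟨u, hu⟩
    rw [hsum, map_sum, LinearMap.sum_apply]
    exact Finset.sum_eq_zero fun j _ => by rw [map_smul, LinearMap.smul_apply, hwy, smul_zero]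
  have hwX : (w : V) ∈ spanOutside p x := h1 ▸ ⟨w.2, hwY⟩
  refine hv (funext fun i => ?_)
  by_cases hi : p i
  · have hle : spanOutside p x ≤ (LinearMap.ker (x.coord i)).map X.1.subtype := by
      rw [spanOutside, Submodule.span_le]
      rintro _ ⟨j, rfl⟩
      refine ⟨x j, ?_, rfl⟩
      have hij : (j : Fin n) ≠ i := by rintro rfl; exact j.2 hi
      simp [hij]
    obtain ⟨w', hw', hww⟩ := hle hwX
    have : w' = w := Subtype.ext hww
    rw [← hwv, ← this]
    exact hw'
  · exact hvp i hi

theorem formMatrix_eq_mul (x x' : Basis (Fin n) F X.1) (y y' : Basis (Fin n) F Y.1) :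
    formMatrix B (fun i => (x' i : V)) (fun i => (y' i : V)) =
      (x.toMatrix x').transpose * formMatrix B (fun i => (x i : V)) (fun i => (y i : V)) *
        y.toMatrix y' := by
  ext i j
  have h1 := coe_eq_sum_repr x (x' i)
  have h2 := coe_eq_sum_repr y (y' j)
  simp only [Matrix.mul_apply, formMatrix, Matrix.of_apply, Matrix.transpose_apply,
    Basis.toMatrix_apply]
  rw [h1, h2, map_sum]
  refine Finset.sum_congr rfl fun l _ => ?_
  rw [map_smul, smul_eq_mul, mul_comm, map_sum, LinearMap.sum_apply]
  congr 1
  refine Finset.sum_congr rfl fun k _ => ?_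
  rw [map_smul, LinearMap.smul_apply, smul_eq_mul]

/-- Change of adapted bases, for a fixed index set. -/
theorem AdaptedOn.exists_sq_mul {x x' : Basis (Fin n) F X.1} {y y' : Basis (Fin n) F Y.1}
    (h : AdaptedOn p x y) (h' : AdaptedOn p x' y') (f : X.1 [⋀^Fin n]→ₗ[F] F)
    (g : Y.1 [⋀^Fin n]→ₗ[F] F) :
    ∃ t : F, t ≠ 0 ∧ f x' * g y' *
      (mask p (formMatrix B (fun i => (x' i : V)) fun i => (y' i : V))).det =
      f x * g y * (mask p (formMatrix B (fun i => (x i : V)) fun i => (y i : V))).det * t ^ 2 := by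
  set A := x.toMatrix x' with hA
  set C := y.toMatrix y' with hC
  -- For j outside p the common vector x' j = y' j lies in X ∩ Y, where the x- and y-coordinates
  -- coincide.
  have hCA : ∀ i j, ¬p j → C i j = A i j := by
    intro i j hj
    rw [hA, hC, Basis.toMatrix_apply, Basis.toMatrix_apply]
    have hxY : ((x' j : X.1) : V) ∈ Y.1 := by rw [h'.eq j hj]; exact (y' j).2
    have h1 : (y' j : Y.1) = ∑ k, x.repr (x' j) k • y k := by
      refine Subtype.ext ?_
      rw [← h'.eq j hj, coe_eq_sum_repr x (x' j)]
      simp only [Submodule.coe_sum, Submodule.coe_smul]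
      refine Finset.sum_congr rfl fun k _ => ?_
      by_cases hk : p k
      · rw [h.repr_eq_zero hxY hk, zero_smul, zero_smul]
      · rw [h.eq k hk]
    rw [h1, y.repr_sum_self]
  have hA0 : ∀ i, p i → ∀ j, ¬p j → A i j = 0 := by
    intro i hi j hj
    rw [hA, Basis.toMatrix_apply]
    exact h.repr_eq_zero (by rw [h'.eq j hj]; exact (y' j).2) hi
  have hC0 : ∀ i, p i → ∀ j, ¬p j → C i j = 0 := by
    intro i hi j hj
    rw [hCA i j hj, hA0 i hi j hj]
  have hAC : mask (fun i => ¬p i) A = mask (fun i => ¬p i) C := by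
    ext i j
    by_cases hj : ¬p j
    · by_cases hi : ¬p i
      · rw [mask_of_pos (p := fun i => ¬p i) hi hj, mask_of_pos (p := fun i => ¬p i) hi hj,
          hCA i j hj]
      · rw [mask_of_neg_left (p := fun i => ¬p i) hi, mask_of_neg_left (p := fun i => ¬p i) hi]
    · rw [mask_of_neg_right (p := fun i => ¬p i) hj, mask_of_neg_right (p := fun i => ¬p i) hj]
  have hdA : f x' = f x * A.det := by
    conv_lhs => rw [f.eq_smul_basis_det x]
    rw [AlternatingMap.smul_apply, Basis.det_apply, smul_eq_mul]
  have hdC : g y' = g y * C.det := by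
    conv_lhs => rw [g.eq_smul_basis_det y]
    rw [AlternatingMap.smul_apply, Basis.det_apply, smul_eq_mul]
  have hdet : (mask p (formMatrix B (fun i => (x' i : V)) fun i => (y' i : V))).det =
      (mask p A).det * (mask p (formMatrix B (fun i => (x i : V)) fun i => (y i : V))).det *
        (mask p C).det := by
    rw [formMatrix_eq_mul x x' y y', mask_mul, mask_mul, Matrix.det_mul, Matrix.det_mul,
      mask_transpose, Matrix.det_transpose]
    · intro i j k _ _ hk
      rw [formMatrix, Matrix.of_apply, form_eq_zero_of_eq h.eq (Or.inl hk), mul_zero]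
    · intro i j k _ _ hk
      rw [Matrix.mul_apply, Finset.sum_eq_zero, zero_mul]
      intro l _
      rw [formMatrix, Matrix.of_apply, form_eq_zero_of_eq h.eq (Or.inr hk), mul_zero]
  -- A and C are block triangular with the same block outside p. The two volume forms contribute det
  -- A · det C and the Gram determinant the p-blocks once more, so each of these three determinants
  -- occurs squared.
  refine ⟨(mask p A).det * (mask p C).det * (mask (fun i => ¬p i) A).det, ?_, ?_⟩
  · have h1 : A.det ≠ 0 := x.isUnit_det x' |>.ne_zero
    have h2 : C.det ≠ 0 := y.isUnit_det y' |>.ne_zero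
    rw [det_mask_mul_det_mask hA0] at h1
    rw [det_mask_mul_det_mask hC0] at h2
    exact mul_ne_zero (mul_ne_zero (left_ne_zero_of_mul h1) (left_ne_zero_of_mul h2))
      (right_ne_zero_of_mul h1)
  · rw [hdA, hdC, hdet, det_mask_mul_det_mask hA0, det_mask_mul_det_mask hC0, ← hAC]
    ring

end Adapted

/-! ### The Maslov index -/

section MaslovIndex

variable {F : Type*} [Field F] {V : Type*} [AddCommGroup V] [Module F V]
  {B : LinearMap.BilinForm F V} {n : ℕ} {X Y Z : Generator B}

/-- The Gram determinant of two bases on the index set `p`. -/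
abbrev gramDet (p : Fin n → Prop) [DecidablePred p] (x : Basis (Fin n) F X.1)
    (y : Basis (Fin n) F Y.1) : F :=
  (mask p (formMatrix B (fun i => (x i : V)) fun i => (y i : V))).det

theorem mask_submatrix {p p' : Fin n → Prop} [DecidablePred p] [DecidablePred p']
    (π : Equiv.Perm (Fin n)) (hπ : ∀ i, p' (π i) ↔ p i) (M : Matrix (Fin n) (Fin n) F) :
    mask p (M.submatrix π π) = (mask p' M).submatrix π π := by
  ext i j
  simp [mask, hπ]

theorem gramDet_reindex {p p' : Fin n → Prop} [DecidablePred p] [DecidablePred p']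
    (π : Equiv.Perm (Fin n)) (hπ : ∀ i, p' (π i) ↔ p i) (x : Basis (Fin n) F X.1)
    (y : Basis (Fin n) F Y.1) :
    gramDet p (x.reindex π.symm) (y.reindex π.symm) = gramDet p' x y := by
  rw [gramDet, gramDet, ← Matrix.det_submatrix_equiv_self π (mask p' _), ← mask_submatrix π hπ]
  congr 2
  ext i j
  simp [formMatrix]

theorem AdaptedOn.reindex {p p' : Fin n → Prop} [DecidablePred p] [DecidablePred p']
    (π : Equiv.Perm (Fin n)) (hπ : ∀ i, p' (π i) ↔ p i) {x : Basis (Fin n) F X.1}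
    {y : Basis (Fin n) F Y.1} (h : AdaptedOn p' x y) :
    AdaptedOn p (x.reindex π.symm) (y.reindex π.symm) := by
  refine ⟨fun i hi => ?_, ?_⟩
  · simpa using h.eq (π i) (by rwa [hπ])
  · exact (gramDet_reindex π hπ x y).trans_ne h.ne_zero

theorem exists_perm_of_card_eq {p p' : Fin n → Prop} [DecidablePred p] [DecidablePred p']
    (h : Fintype.card {i // p i} = Fintype.card {i // p' i}) :
    ∃ π : Equiv.Perm (Fin n), ∀ i, p' (π i) ↔ p i := by
  let e : {i // p i} ≃ {i // p' i} := Fintype.equivOfCardEq h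
  refine ⟨e.extendSubtype, fun i => ⟨fun hi => ?_, fun hi => e.extendSubtype_mem i hi⟩⟩
  by_contra hni
  exact e.extendSubtype_not_mem i hni hi

variable [FiniteDimensional F V]

/-- Adapted bases give the same value up to squares. -/
theorem AdaptedOn.exists_sq_mul_of_adaptedOn (hB : IsSymplectic B n) {p p' : Fin n → Prop}
    [DecidablePred p] [DecidablePred p'] {x x' : Basis (Fin n) F X.1}
    {y y' : Basis (Fin n) F Y.1} (h : AdaptedOn p x y) (h' : AdaptedOn p' x' y')
    (f : X.1 [⋀^Fin n]→ₗ[F] F) (g : Y.1 [⋀^Fin n]→ₗ[F] F) :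
    ∃ t : F, t ≠ 0 ∧ f x' * g y' * gramDet p' x' y' = f x * g y * gramDet p x y * t ^ 2 := by
  obtain ⟨π, hπ⟩ := exists_perm_of_card_eq ((h.card_eq hB).trans (h'.card_eq hB).symm)
  obtain ⟨t, ht, he⟩ := h.exists_sq_mul (h'.reindex π hπ) f g
  refine ⟨t, ht, ?_⟩
  rw [← he]
  -- Permuting both bases alike multiplies both forms by the same sign, which cancels in the
  -- product.
  have h1 : f (x'.reindex π.symm) = Equiv.Perm.sign π • f x' := by
    rw [← f.map_perm]; congr 1; ext i; simp
  have h2 : g (y'.reindex π.symm) = Equiv.Perm.sign π • g y' := by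
    rw [← g.map_perm]; congr 1; ext i; simp
  have h3 := gramDet_reindex π hπ x' y'
  rw [gramDet] at h3
  rw [h1, h2, h3, smul_mul_smul_comm, Int.units_mul_self, one_smul]

theorem IsSymplectic.exists_adaptedOn (hB : IsSymplectic B n) (X Y : Generator B) :
    ∃ (p : Fin n → Prop) (_ : DecidablePred p) (x : Basis (Fin n) F X.1)
      (y : Basis (Fin n) F Y.1), AdaptedOn p x y := by
  obtain ⟨x, y, h⟩ := hB.exists_isAdapted X Y
  exact ⟨fun i => (i : ℕ) < genDist X Y, inferInstance, x, y,
    adaptedOn_of_card_eq hB (fun i hi => h i (not_lt.1 hi))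
      (Fintype.card_fin_lt_of_le (hB.genDist_le X Y))⟩

section Finite

variable [Fintype F] [DecidableEq F] {δ : ∀ X : Generator B, X.1 [⋀^Fin n]→ₗ[F] F}

theorem quadraticChar_mul_sq (a : F) {t : F} (ht : t ≠ 0) :
    quadraticChar F (a * t ^ 2) = quadraticChar F a := by
  rw [map_mul, quadraticChar_sq_one' ht, mul_one]

theorem maslovIndex_eq (hB : IsSymplectic B n) {p : Fin n → Prop} [DecidablePred p]
    {x : Basis (Fin n) F X.1} {y : Basis (Fin n) F Y.1} (h : AdaptedOn p x y) :
    maslovIndex δ X Y = quadraticChar F (δ X x * δ Y y * gramDet p x y) := by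
  obtain ⟨x₀, y₀, h₀⟩ := hB.exists_isAdapted X Y
  have hex : ∃ b : Basis (Fin n) F X.1 × Basis (Fin n) F Y.1, IsAdapted b.1 b.2 := ⟨(x₀, y₀), h₀⟩
  rw [maslovIndex, dif_pos hex]
  have hspec := hex.choose_spec
  generalize hex.choose = b at hspec
  obtain ⟨x', y'⟩ := b
  have h' : AdaptedOn (fun i : Fin n => (i : ℕ) < genDist X Y) x' y' :=
    adaptedOn_of_card_eq hB (fun i hi => hspec i (not_lt.1 hi))
      (Fintype.card_fin_lt_of_le (hB.genDist_le X Y))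
  obtain ⟨t, ht, he⟩ := h.exists_sq_mul_of_adaptedOn hB h' (δ X) (δ Y)
  rw [← quadraticChar_mul_sq _ ht, ← he, gramDet, det_mask]
  rfl

variable (hδ : ∀ X, δ X ≠ 0)

include hδ in
theorem maslovIndex_sq (hB : IsSymplectic B n) : maslovIndex δ X Y ^ 2 = 1 := by
  obtain ⟨p, _, x, y, h'⟩ := hB.exists_adaptedOn X Y
  rw [maslovIndex_eq hB h']
  exact quadraticChar_sq_one (mul_ne_zero (mul_ne_zero
    ((AlternatingMap.map_basis_ne_zero_iff x _).2 (hδ X))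
    ((AlternatingMap.map_basis_ne_zero_iff y _).2 (hδ Y))) h'.ne_zero)

include hδ in
theorem maslovIndex_self (hB : IsSymplectic B n) : maslovIndex δ X X = 1 := by
  let x : Basis (Fin n) F X.1 := finBasisOfFinrankEq F X.1 (hB.finrank_generator X)
  have hm : ∀ M : Matrix (Fin n) (Fin n) F, mask (fun _ => False) M = 1 := by
    intro M; ext i j; simp [mask, Matrix.one_apply]
  -- At distance 0 the index set is empty and the Gram determinant is 1, so the value is χ of the
  -- square of δ X x.
  have h : AdaptedOn (fun _ : Fin n => False) x x := ⟨fun _ _ => rfl, by rw [hm]; simp⟩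
  rw [maslovIndex_eq hB h, gramDet, hm, Matrix.det_one, mul_one, ← sq]
  exact quadraticChar_sq_one' ((AlternatingMap.map_basis_ne_zero_iff x _).2 (hδ X))

theorem quadraticChar_neg_one_eq_one (hq : Fintype.card F % 4 = 1) : quadraticChar F (-1) = 1 := by
  rw [quadraticChar_one_iff_isSquare (neg_ne_zero.2 one_ne_zero), FiniteField.isSquare_neg_one_iff]
  omega

theorem quadraticChar_neg (hq : Fintype.card F % 4 = 1) (a : F) :
    quadraticChar F (-a) = quadraticChar F a := by
  rw [← neg_one_mul, map_mul, quadraticChar_neg_one_eq_one hq, one_mul]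

/-- Exchanging X and Y transposes and negates the Gram matrix, at the cost of a power of -1, which
is a square since q ≡ 1 mod 4. -/
theorem maslovIndex_comm (hB : IsSymplectic B n) (hq : Fintype.card F % 4 = 1) :
    maslovIndex δ X Y = maslovIndex δ Y X := by
  obtain ⟨p, _, x, y, h1⟩ := hB.exists_adaptedOn X Y
  have h2 : AdaptedOn p y x := adaptedOn_of_card_eq hB (fun i hi => (h1.eq i hi).symm)
    ((h1.card_eq hB).trans (hB.genDist_comm X Y))
  have hdet : gramDet p y x = (-1) ^ Fintype.card {i // p i} * gramDet p x y := by
    rw [gramDet, gramDet, det_mask, det_mask, ← Matrix.det_neg, ← Matrix.det_transpose]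
    congr 1
    ext i j
    simp only [Matrix.toSquareBlockProp, formMatrix, Matrix.transpose_apply,
      Matrix.neg_apply]
    exact hB.eq_neg _ _
  rw [maslovIndex_eq hB h1, maslovIndex_eq hB h2, hdet]
  rw [show δ Y y * δ X x * ((-1) ^ Fintype.card {i // p i} * gramDet p x y) =
    (-1) ^ Fintype.card {i // p i} * (δ X x * δ Y y * gramDet p x y) by ring,
    map_mul _ ((-1) ^ _), map_pow, quadraticChar_neg_one_eq_one hq, one_pow, one_mul]

end Finite

/-! ### Triangles with a neighbour -/

theorem exists_basis_sub_smul {ι M : Type*} [Finite ι] [AddCommGroup M] [Module F M]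
    (x : Basis ι F M) (i₀ : ι) {c : ι → F} (hc : c i₀ = 0) :
    ∃ x' : Basis ι F M, ∀ i, x' i = x i - c i • x i₀ := by
  have h : (x.constr F fun i => -c i) (x i₀) = 0 := by rw [x.constr_basis, hc, neg_zero]
  refine ⟨x.map (LinearEquiv.transvection h), fun i => ?_⟩
  rw [Basis.map_apply, LinearEquiv.transvection.apply, x.constr_basis, neg_smul, sub_eq_add_neg]

/-- A basis of the neighbour `Z` of `X`. -/
theorem IsSymplectic.exists_neighbour_basis (hB : IsSymplectic B n) {v : V} (hv : v ∉ X.1)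
    (hvZ : v ∈ Z.1) (hd : genDist X Z = 1) (x : Basis (Fin n) F X.1) {i₀ : Fin n}
    (h0 : B (x i₀ : V) v ≠ 0) (hne : ∀ i, i ≠ i₀ → B (x i : V) v = 0) :
    ∃ z : Basis (Fin n) F Z.1, (z i₀ : V) = v ∧ ∀ i, i ≠ i₀ → (z i : V) = x i := by
  have hmem : ∀ i, i ≠ i₀ → (x i : V) ∈ Z.1 := by
    intro i hi
    have : (x i : V) ∈ X.1 ⊓ Z.1 := by
      rw [hB.inf_eq_hyperplane hv hvZ hd, hB.mem_hyperplane]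
      exact ⟨(x i).2, hne i hi⟩
    exact this.2
  let z : Fin n → Z.1 := fun i => if h : i = i₀ then ⟨v, hvZ⟩ else ⟨x i, hmem i h⟩
  have hz0 : (z i₀ : V) = v := by simp [z]
  have hz : ∀ i, i ≠ i₀ → (z i : V) = x i := fun i hi => by simp [z, hi]
  have hli : LinearIndependent F z := by
    rw [Fintype.linearIndependent_iff]
    intro c hc
    have hcV : ∑ i, c i • (z i : V) = 0 := by
      have := congrArg Subtype.val hc
      simpa using this
    have hc0 : c i₀ = 0 := by
      have h1 := congrArg (B (x i₀ : V)) hcV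
      rw [map_sum, map_zero, Finset.sum_eq_single i₀, map_smul, hz0, smul_eq_mul] at h1
      · exact (mul_eq_zero.1 h1).resolve_right h0
      · intro i _ hi
        rw [map_smul, hz i hi, X.form_eq_zero (x i₀).2 (x i).2, smul_zero]
      · simp
    have hcX : ∑ i, c i • x i = 0 := by
      refine Subtype.ext ?_
      rw [Submodule.coe_sum, Submodule.coe_zero, ← hcV]
      refine Finset.sum_congr rfl fun i _ => ?_
      by_cases hi : i = i₀
      · rw [hi, hc0, zero_smul, zero_smul, Submodule.coe_zero]
      · rw [hz i hi, Submodule.coe_smul]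
    exact Fintype.linearIndependent_iff.1 x.linearIndependent c hcX
  have : Nonempty (Fin n) := ⟨i₀⟩
  refine ⟨basisOfLinearIndependentOfCardEqFinrank hli
    (by rw [Fintype.card_fin, hB.finrank_generator]), ?_, fun i hi => ?_⟩
  · rw [coe_basisOfLinearIndependentOfCardEqFinrank, hz0]
  · rw [coe_basisOfLinearIndependentOfCardEqFinrank, hz i hi]

/-- Adapted bases such that all but one of the basis vectors of `X` are orthogonal to `v`. -/
theorem exists_adapted_hyperplane (hB : IsSymplectic B n) {v : V} {p : Fin n → Prop}
    [DecidablePred p] {x : Basis (Fin n) F X.1} {y : Basis (Fin n) F Y.1} (h : AdaptedOn p x y)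
    {i₀ : Fin n} (h0 : B (x i₀ : V) v ≠ 0) (hp : ¬p i₀ ∨ ∀ i, ¬p i → B (x i : V) v = 0) :
    ∃ (x' : Basis (Fin n) F X.1) (y' : Basis (Fin n) F Y.1), AdaptedOn p x' y' ∧
      B (x' i₀ : V) v ≠ 0 ∧ ∀ i, i ≠ i₀ → B (x' i : V) v = 0 := by
  let c : Fin n → F := fun i => if i = i₀ then 0 else B (x i : V) v / B (x i₀ : V) v
  obtain ⟨x', hx'⟩ := exists_basis_sub_smul x i₀ (c := c) (by simp [c])
  -- If i₀ is outside p, then x and y share the vector at i₀ and are changed alike, so they still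
  -- agree outside p. If i₀ is in p, then by `hp` the coefficients outside p are zero already and y
  -- stays.
  obtain ⟨y', hy'⟩ := exists_basis_sub_smul y i₀
    (c := fun i => if p i₀ then 0 else c i) (by simp [c])
  refine ⟨x', y', adaptedOn_of_card_eq hB (fun i hi => ?_) (h.card_eq hB), ?_, fun i hi => ?_⟩
  · rw [hx', hy', Submodule.coe_sub, Submodule.coe_sub, Submodule.coe_smul, Submodule.coe_smul,
      h.eq i hi]
    by_cases hp0 : p i₀
    · have h1 := hp.resolve_left (not_not.2 hp0) i hi
      simp [c, hp0, h1]
    · rw [h.eq i₀ hp0, if_neg hp0]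
  · rw [hx']
    simpa [c] using h0
  · rw [hx']
    simp [c, hi, h0]

theorem det_toSquareBlockProp_eq (i₀ : Fin n) (M : Matrix (Fin n) (Fin n) F) :
    @Matrix.det {i // i = i₀} _ (Subtype.fintype _) F _ (M.toSquareBlockProp fun i => i = i₀) =
      M i₀ i₀ :=
  @Matrix.det_eq_elem_of_subsingleton {i // i = i₀} _ (Subtype.fintype _) F _ _ _ ⟨i₀, rfl⟩

theorem det_mask_eq_entry (i₀ : Fin n) (M : Matrix (Fin n) (Fin n) F) :
    (mask (fun i => i = i₀) M).det = M i₀ i₀ := by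
  rw [det_mask]
  exact det_toSquareBlockProp_eq i₀ M

/-- On the enlarged index set column i₀ has only its diagonal entry, so the determinant expands
along it. -/
theorem det_mask_insert {p p' : Fin n → Prop} [DecidablePred p] [DecidablePred p'] {i₀ : Fin n}
    (hp : ¬p i₀) (hp' : ∀ i, p' i ↔ p i ∨ i = i₀) {M M' : Matrix (Fin n) (Fin n) F}
    (hM : ∀ i j, p i → p j → M' i j = M i j) (h0 : ∀ i, p i → M' i i₀ = 0) :
    (mask p' M').det = M' i₀ i₀ * (mask p M).det := by
  have hpi : ∀ i, p i → i ≠ i₀ := by rintro i hi rfl; exact hp hi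
  have hz : ∀ i, i ≠ i₀ → mask p' M' i i₀ = 0 := by
    intro i hi
    by_cases hpi' : p i
    · rw [mask_of_pos ((hp' i).2 (Or.inl hpi')) ((hp' i₀).2 (Or.inr rfl)), h0 i hpi']
    · rw [mask_of_neg_left (by rw [hp']; tauto), if_neg hi]
  rw [Matrix.twoBlockTriangular_det (mask p' M') (fun i => i = i₀) (by
      rintro i hi j rfl; exact hz i hi),
    Matrix.twoBlockTriangular_det (mask p M) (fun i => i = i₀) (by
      rintro i hi j rfl; rw [mask_of_neg_right hp, if_neg hi]),
    det_toSquareBlockProp_eq, det_toSquareBlockProp_eq, ← mul_assoc]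
  congr 1
  · change mask p' M' i₀ i₀ = M' i₀ i₀ * mask p M i₀ i₀
    rw [mask_of_pos ((hp' i₀).2 (Or.inr rfl)) ((hp' i₀).2 (Or.inr rfl)), mask_of_neg_left hp,
      if_pos rfl, mul_one]
  · congr 1
    ext ⟨i, hi⟩ ⟨j, hj⟩
    change mask p' M' i j = mask p M i j
    simp only [mask, Matrix.of_apply, hp', hi, hj, or_false]
    split_ifs with h1 h2
    · exact hM i j h1 h2
    all_goals rfl

section Finite

variable [Fintype F] [DecidableEq F] {δ : ∀ X : Generator B, X.1 [⋀^Fin n]→ₗ[F] F}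

theorem maslovIndex_neighbour (hB : IsSymplectic B n) {x : Basis (Fin n) F X.1}
    {z : Basis (Fin n) F Z.1} {i₀ : Fin n} (hz : ∀ i, i ≠ i₀ → (z i : V) = x i)
    (h0 : B (x i₀ : V) (z i₀ : V) ≠ 0) :
    maslovIndex δ X Z = quadraticChar F (δ X x * δ Z z * B (x i₀ : V) (z i₀ : V)) := by
  have hdet : gramDet (fun i => i = i₀) x z = B (x i₀ : V) (z i₀ : V) := det_mask_eq_entry i₀ _
  have h : AdaptedOn (fun i => i = i₀) x z := ⟨fun i hi => (hz i hi).symm, hdet.trans_ne h0⟩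
  rw [maslovIndex_eq hB h, hdet]

/-- If some vector of `X ∩ Y` is not orthogonal to `v`, then the neighbour `Z` of `X` through `v`
is farther from `Y` than `X`, and the Maslov index is multiplicative. -/
theorem maslovIndex_away (hB : IsSymplectic B n) (hq : Fintype.card F % 4 = 1)
    (hδ : ∀ X, δ X ≠ 0) {v : V} (hv : v ∉ X.1) (hvZ : v ∈ Z.1) (hd : genDist X Z = 1)
    {u : V} (hu : u ∈ X.1 ⊓ Y.1) (huv : B u v ≠ 0) :
    genDist Z Y = genDist X Y + 1 ∧
      maslovIndex δ X Z * maslovIndex δ Z Y = maslovIndex δ X Y := by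
  obtain ⟨p, _, x₀, y₀, h₀⟩ := hB.exists_adaptedOn X Y
  -- The vectors outside p span X ∩ Y, which contains u, so one of them is not orthogonal to v.
  obtain ⟨i₀, hi₀, hxv⟩ : ∃ i, ¬p i ∧ B (x₀ i : V) v ≠ 0 := by
    by_contra! hcon
    refine huv ?_
    have hsum : u = _ := coe_eq_sum_repr x₀ ⟨u, hu.1⟩
    rw [hsum, map_sum, LinearMap.sum_apply]
    refine Finset.sum_eq_zero fun k _ => ?_
    rw [map_smul, LinearMap.smul_apply]
    by_cases hk : p k
    · rw [h₀.repr_eq_zero (w := ⟨u, hu.1⟩) hu.2 hk, zero_smul]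
    · rw [hcon k hk, smul_zero]
  obtain ⟨x, y, h, h0, hne⟩ := exists_adapted_hyperplane hB h₀ hxv (Or.inl hi₀)
  obtain ⟨z, hz0, hz⟩ := hB.exists_neighbour_basis hv hvZ hd x h0 hne
  let p' : Fin n → Prop := fun i => p i ∨ i = i₀
  have hyv : B v (y i₀ : V) = -B (x i₀ : V) v := by
    rw [← h.eq i₀ hi₀, hB.eq_neg]
  have hdet : gramDet p' z y = -B (x i₀ : V) v * gramDet p x y := by
    rw [gramDet, det_mask_insert (M := formMatrix B (fun i => (x i : V)) fun i => (y i : V)) hi₀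
      (fun i => Iff.rfl)]
    · rw [formMatrix, Matrix.of_apply, hz0, hyv]
    · intro i j hi _
      simp only [formMatrix, Matrix.of_apply]
      rw [hz i (by rintro rfl; exact hi₀ hi)]
    · intro i hi
      simp only [formMatrix, Matrix.of_apply]
      rw [hz i (by rintro rfl; exact hi₀ hi), ← h.eq i₀ hi₀]
      exact X.form_eq_zero (x i).2 (x i₀).2
  have hzy : AdaptedOn p' z y := by
    refine ⟨fun i hi => ?_, hdet.trans_ne (mul_ne_zero (neg_ne_zero.2 h0) h.ne_zero)⟩
    rw [hz i (fun h => hi (Or.inr h)), h.eq i (fun h => hi (Or.inl h))]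
  constructor
  · rw [← hzy.card_eq hB, ← h.card_eq hB, Fintype.card_subtype, Fintype.card_subtype]
    have : Finset.univ.filter p' = insert i₀ (Finset.univ.filter p) := by
      ext i; simp [p', or_comm]
    rw [this, Finset.card_insert_of_notMem (by simpa using hi₀)]
  · have hδz : δ Z z ≠ 0 := (AlternatingMap.map_basis_ne_zero_iff z _).2 (hδ Z)
    -- The product of the two arguments is the one for (X, Y), times -1, times the square of δ Z z ·
    -- B (x i₀) v. Both extra factors are squares.
    rw [maslovIndex_neighbour hB hz (by rwa [hz0]), maslovIndex_eq hB hzy, maslovIndex_eq hB h,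
      hdet, hz0, ← map_mul, ← quadraticChar_neg hq (δ X x * δ Y y * _),
      ← quadraticChar_mul_sq (-(δ X x * δ Y y * _)) (mul_ne_zero hδz h0)]
    congr 1
    ring

/-- If `v = a + b` with `a ∈ X`, `b ∈ Y` and `B a b ≠ 0`, then the neighbour `Z` of `X` through
`v` is at the same distance from `Y` as `X`. -/
theorem maslovIndex_level (hB : IsSymplectic B n) (hδ : ∀ X, δ X ≠ 0) {a b : V}
    (ha : a ∈ X.1) (hb : b ∈ Y.1) (hab : B a b ≠ 0) (hvZ : a + b ∈ Z.1) (hd : genDist X Z = 1) :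
    genDist Z Y = genDist X Y ∧
      maslovIndex δ X Z * maslovIndex δ Z Y = maslovIndex δ X Y * quadraticChar F (B a b) := by
  obtain ⟨p, _, x₀, y₀, h₀⟩ := hB.exists_adaptedOn X Y
  have hav : B a (a + b) = B a b := by rw [map_add, hB.alt a, zero_add]
  have hv : a + b ∉ X.1 := fun h => hab (hav ▸ X.form_eq_zero ha h)
  have hinf : ∀ w ∈ X.1, w ∈ Y.1 → B w (a + b) = 0 := by
    intro w hwX hwY
    rw [map_add, X.form_eq_zero hwX ha, Y.form_eq_zero hwY hb, add_zero]
  obtain ⟨i₀, hxv⟩ : ∃ i, B (x₀ i : V) (a + b) ≠ 0 := by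
    by_contra! hcon
    refine hab ?_
    rw [← hav]
    have hsum : a = _ := coe_eq_sum_repr x₀ ⟨a, ha⟩
    generalize a + b = v at hcon ⊢
    rw [hsum, map_sum, LinearMap.sum_apply]
    refine Finset.sum_eq_zero fun k _ => ?_
    rw [map_smul, LinearMap.smul_apply, hcon k, smul_zero]
  have hmemY : ∀ {x : Basis (Fin n) F X.1} {y : Basis (Fin n) F Y.1}, AdaptedOn p x y →
      ∀ i, ¬p i → B (x i : V) (a + b) = 0 := by
    intro x y h i hi
    exact hinf _ (x i).2 (by rw [h.eq i hi]; exact (y i).2)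
  obtain ⟨x, y, h, h0, hne⟩ := exists_adapted_hyperplane hB h₀ hxv (Or.inr (hmemY h₀))
  obtain ⟨z, hz0, hz⟩ := hB.exists_neighbour_basis hv hvZ hd x h0 hne
  have hi₀ : p i₀ := by
    by_contra hi
    exact h0 (hmemY h i₀ hi)
  set c : Fin n → F := fun k => x.repr ⟨a, ha⟩ k with hc
  have hsum : a = ∑ k, c k • (x k : V) := coe_eq_sum_repr x ⟨a, ha⟩
  have hcb : B a b = c i₀ * B (x i₀ : V) (a + b) := by
    rw [← hav]
    generalize a + b = v at hne ⊢
    rw [hsum, map_sum, LinearMap.sum_apply, Finset.sum_eq_single i₀]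
    · rw [map_smul, LinearMap.smul_apply, smul_eq_mul]
    · intro i _ hi
      rw [map_smul, LinearMap.smul_apply, hne i hi, smul_zero]
    · simp
  -- Since b is orthogonal to Y, row i₀ of the new Gram matrix is the row of a, a combination of the
  -- old rows with coefficients c k; only the i₀-th contributes to the determinant. By `hcb`, the
  -- factor c i₀ and the entry B (x i₀) (a + b) from the pair (X, Z) combine to B a b.
  have hdet : gramDet p z y = c i₀ * gramDet p x y := by
    set M := mask p (formMatrix B (fun i => (x i : V)) fun i => (y i : V)) with hM
    have hrow : mask p (formMatrix B (fun i => (z i : V)) fun i => (y i : V)) =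
        M.updateRow i₀ (∑ k, (if p k then c k else 0) • M k) := by
      ext i j
      by_cases hi : i = i₀
      · subst hi
        rw [Matrix.updateRow_self, Finset.sum_apply]
        simp only [Pi.smul_apply, smul_eq_mul]
        by_cases hj : p j
        · rw [mask_of_pos hi₀ hj, formMatrix, Matrix.of_apply, hz0, map_add, LinearMap.add_apply,
            Y.form_eq_zero hb (y j).2, add_zero, hsum, map_sum, LinearMap.sum_apply]
          refine Finset.sum_congr rfl fun k _ => ?_
          rw [map_smul, LinearMap.smul_apply, smul_eq_mul]
          by_cases hk : p k
          · rw [if_pos hk, hM, mask_of_pos hk hj]; rfl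
          · rw [if_neg hk, form_eq_zero_of_eq h.eq (Or.inl hk), mul_zero, zero_mul]
        · rw [mask_of_neg_right hj, if_neg (by rintro rfl; exact hj hi₀)]
          refine (Finset.sum_eq_zero fun k _ => ?_).symm
          rw [hM, mask_of_neg_right hj]
          split_ifs with h1 h2
          · subst h2; exact absurd h1 hj
          all_goals simp
      · rw [Matrix.updateRow_ne hi, hM]
        simp only [mask, formMatrix, Matrix.of_apply, hz i hi]
    rw [gramDet, hrow, Matrix.det_updateRow_sum, if_pos hi₀, smul_eq_mul]
  have hc0 : c i₀ ≠ 0 := fun h => hab (by rw [hcb, h, zero_mul])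
  have hzy : AdaptedOn p z y := by
    refine ⟨fun i hi => ?_, hdet.trans_ne (mul_ne_zero hc0 h.ne_zero)⟩
    rw [hz i (by rintro rfl; exact hi hi₀), h.eq i hi]
  refine ⟨by rw [← hzy.card_eq hB, ← h.card_eq hB], ?_⟩
  have hδz : δ Z z ≠ 0 := (AlternatingMap.map_basis_ne_zero_iff z _).2 (hδ Z)
  rw [maslovIndex_neighbour hB hz (by rwa [hz0]), maslovIndex_eq hB hzy, maslovIndex_eq hB h,
    hdet, hz0, ← map_mul, ← map_mul, hcb, ← quadraticChar_mul_sq (δ X x * δ Y y * _ * _) hδz]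
  congr 1
  ring

/-- If `v = a + b` with `a ∈ X`, `b ∈ Y` and `B a b = 0`, then the neighbour `Z` of `X` through
`v` is closer to `Y` than `X`, and the Maslov index is multiplicative. -/
theorem maslovIndex_toward (hB : IsSymplectic B n) (hq : Fintype.card F % 4 = 1)
    (hδ : ∀ X, δ X ≠ 0) {a b : V} (ha : a ∈ X.1) (hb : b ∈ Y.1) (hbX : b ∉ X.1)
    (hab : B a b = 0) (hvZ : a + b ∈ Z.1) (hd : genDist X Z = 1) :
    genDist X Y = genDist Z Y + 1 ∧
      maslovIndex δ X Z * maslovIndex δ Z Y = maslovIndex δ X Y := by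
  have hv : a + b ∉ X.1 := fun h => hbX ((Submodule.add_mem_iff_right _ ha).1 h)
  have haZ : a ∈ Z.1 := by
    have : a ∈ X.1 ⊓ Z.1 := by
      rw [hB.inf_eq_hyperplane hv hvZ hd, hB.mem_hyperplane, map_add, hB.alt a, hab, add_zero]
      exact ⟨ha, rfl⟩
    exact this.2
  have hbZ : b ∈ Z.1 := (Submodule.add_mem_iff_right _ haZ).1 hvZ
  -- X is the neighbour of Z through u, and b in Z ∩ Y is not orthogonal to u. So this is the case
  -- of `maslovIndex_away` with X and Z exchanged.
  obtain ⟨u, huX, hub⟩ : ∃ u ∈ X.1, B u b ≠ 0 := by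
    by_contra! hcon
    exact hbX (X.mem_iff.2 hcon)
  have huZ : u ∉ Z.1 := fun h => hub (Z.form_eq_zero h hbZ)
  have hbu : B b u ≠ 0 := fun h => hub (hB.eq_zero_comm.1 h)
  obtain ⟨h1, h2⟩ := maslovIndex_away hB hq hδ huZ huX ((hB.genDist_comm Z X).trans hd)
    (Submodule.mem_inf.2 ⟨hbZ, hb⟩) hbu
  refine ⟨h1, ?_⟩
  have h3 := maslovIndex_sq (X := Z) (Y := X) hδ hB
  rw [← h2, maslovIndex_comm hB hq (X := X) (Y := Z), ← mul_assoc, ← sq, h3, one_mul]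

end Finite

end MaslovIndex

/-! ### The three-term recurrence of the signed distance matrices -/

section Counting

variable {F : Type*} [Field F] [Fintype F]

theorem sum_comp_linearMap {U W : Type*} [AddCommGroup U] [Module F U] [AddCommGroup W] [Module F W]
    [Fintype U] [Fintype W] [DecidableEq W] (f : U →ₗ[F] W) [DecidablePred (· ∈ LinearMap.range f)]
    (g : W → ℝ) :
    ∑ u, g (f u) = (Fintype.card F : ℝ) ^ finrank F (LinearMap.ker f) *
      ∑ w with w ∈ LinearMap.range f, g w := by
  rw [← Finset.sum_fiberwise (s := Finset.univ) (g := fun u => f u), Finset.mul_sum,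
    Finset.sum_filter]
  refine Finset.sum_congr rfl fun w _ => ?_
  rw [Finset.sum_congr rfl (g := fun _ => g w) (fun u hu => by rw [(Finset.mem_filter.1 hu).2]),
    Finset.sum_const, nsmul_eq_mul]
  split_ifs with hw
  · congr 1
    obtain ⟨u₀, rfl⟩ := hw
    classical
    have h : Fintype.card (LinearMap.ker f) = Fintype.card F ^ finrank F (LinearMap.ker f) :=
      Module.card_eq_pow_finrank
    rw [← Nat.cast_pow, ← h, ← Fintype.card_subtype]
    let e : {u // f u = f u₀} ≃ LinearMap.ker f :=
      { toFun := fun u => ⟨u - u₀, by rw [LinearMap.mem_ker, map_sub, u.2, sub_self]⟩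
        invFun := fun k => ⟨k + u₀, by rw [map_add, k.2, zero_add]⟩
        left_inv := fun u => by simp
        right_inv := fun k => by simp }
    exact congrArg _ (Fintype.card_congr e)
  · rw [Finset.filter_false_of_mem fun u _ h => hw ⟨u, h⟩]
    simp

variable {V : Type*} [AddCommGroup V] [Module F V] [Finite V] {B : LinearMap.BilinForm F V}
  {n : ℕ}

/-- The properties of the Maslov index `τ` on which the three-term recurrence relies. Here `ψ`
describes the defect for triangles. -/
structure IsTriangleIndex (B : LinearMap.BilinForm F V) (τ : Generator B → Generator B → ℝ)
    (ψ : F → ℝ) : Prop where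
  sq : ∀ X Y, τ X Y * τ X Y = 1
  self : ∀ X, τ X X = 1
  comm : ∀ X Y, τ X Y = τ Y X
  zero : ψ 0 = 0
  away : ∀ {X Y Z : Generator B} {u v : V}, v ∉ X.1 → v ∈ Z.1 → genDist X Z = 1 →
    u ∈ X.1 ⊓ Y.1 → B u v ≠ 0 → genDist Z Y = genDist X Y + 1 ∧ τ X Z * τ Z Y = τ X Y
  level : ∀ {X Y Z : Generator B} {a b : V}, a ∈ X.1 → b ∈ Y.1 → B a b ≠ 0 → a + b ∈ Z.1 →
    genDist X Z = 1 → genDist Z Y = genDist X Y ∧ τ X Z * τ Z Y = τ X Y * ψ (B a b)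
  toward : ∀ {X Y Z : Generator B} {a b : V}, a ∈ X.1 → b ∈ Y.1 → b ∉ X.1 → B a b = 0 →
    a + b ∈ Z.1 → genDist X Z = 1 → genDist X Y = genDist Z Y + 1 ∧ τ X Z * τ Z Y = τ X Y

/-- The distance matrices of the generators, signed by `τ`. -/
def signedDist (τ : Generator B → Generator B → ℝ) (k : ℕ) :
    Matrix (Generator B) (Generator B) ℝ :=
  Matrix.of fun X Y => if genDist X Y = k then τ X Y else 0

theorem card_filter_mem [Fintype V] (U : Submodule F V) [DecidablePred (· ∈ U)] :
    (((Finset.univ.filter (· ∈ U)).card : ℕ) : ℝ) = (Fintype.card F : ℝ) ^ finrank F U := by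
  rw [← Fintype.card_subtype, ← Nat.cast_pow]
  exact congrArg _ (Module.card_eq_pow_finrank (K := F) (V := U))

theorem card_filter_mem_not_mem [Fintype V] (U W : Submodule F V) [DecidablePred (· ∈ U)]
    [DecidablePred (· ∈ W)] :
    (((Finset.univ.filter fun v => v ∈ U ∧ v ∉ W).card : ℕ) : ℝ) =
      (Fintype.card F : ℝ) ^ finrank F U -
        (Fintype.card F : ℝ) ^ finrank F (U ⊓ W : Submodule F V) := by
  classical
  rw [← card_filter_mem, ← card_filter_mem, eq_sub_iff_add_eq, ← Nat.cast_add,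
    ← Finset.card_filter_add_card_filter_not (s := Finset.univ.filter (· ∈ U)) (· ∈ W),
    Finset.filter_filter, Finset.filter_filter, add_comm]
  simp only [Submodule.mem_inf]

open Classical in
/-- The sum of `g` over the neighbours of `X` through `v`. -/
def throughSum (X : Generator B) (g : Generator B → ℝ) (v : V) : ℝ :=
  ∑ Z : Generator B, if genDist X Z = 1 ∧ v ∈ Z.1 then g Z else 0

theorem IsSymplectic.exists_throughSum_eq (hB : IsSymplectic B n) {X : Generator B} {v : V}
    (hv : v ∉ X.1) (g : Generator B → ℝ) :
    ∃ Z : Generator B, genDist X Z = 1 ∧ v ∈ Z.1 ∧ throughSum X g v = g Z := by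
  obtain ⟨Z, ⟨h1, h2⟩, huniq⟩ := hB.existsUnique_neighbour hv
  refine ⟨Z, h1, h2, ?_⟩
  rw [throughSum, Finset.sum_eq_single Z, if_pos ⟨h1, h2⟩]
  · intro Z' _ hne
    exact if_neg fun h => hne (huniq Z' h)
  · simp

open Classical in
-- Each neighbour Z is counted once for every vector of Z outside X, that is q^n - q^(n-1) times.
-- The factor q clears the exponent n - 1.
theorem IsSymplectic.sum_throughSum [Fintype V] (hB : IsSymplectic B n) (X : Generator B)
    (g : Generator B → ℝ) :
    (Fintype.card F : ℝ) * ∑ v with v ∉ X.1, throughSum X g v =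
      (Fintype.card F : ℝ) ^ n * ((Fintype.card F : ℝ) - 1) *
        ∑ Z : Generator B, if genDist X Z = 1 then g Z else 0 := by
  simp only [throughSum]
  rw [Finset.sum_comm, Finset.mul_sum, Finset.mul_sum]
  refine Finset.sum_congr rfl fun Z _ => ?_
  by_cases hd : genDist X Z = 1
  · have h1 := hB.genDist_add_finrank Z X
    rw [hB.genDist_comm, hd] at h1
    have h2 : (Finset.univ.filter fun v => v ∉ X.1).filter (fun v => v ∈ Z.1) =
        Finset.univ.filter fun v => v ∈ Z.1 ∧ v ∉ X.1 := by
      ext v; simp [and_comm]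
    simp only [hd, true_and, if_true]
    rw [← Finset.sum_filter, h2, Finset.sum_const, nsmul_eq_mul, card_filter_mem_not_mem,
      hB.finrank_generator]
    conv_rhs => rw [← h1]
    conv_lhs => rw [← h1]
    ring
  · simp [hd]

/-- The functional x ↦ B x y is nonzero on X, so it takes each value equally often. -/
theorem IsSymplectic.sum_form (hB : IsSymplectic B n) (X : Generator B) [Fintype X.1] {y : V}
    (hy : y ∉ X.1) (κ : F → ℝ) :
    (Fintype.card F : ℝ) * ∑ x : X.1, κ (B x y) = (Fintype.card F : ℝ) ^ n * ∑ t, κ t := by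
  classical
  set f : X.1 →ₗ[F] F := (B.flip y).comp X.1.subtype with hf
  have hf0 : f ≠ 0 := by
    intro h
    refine hy (X.mem_iff.2 fun x hx => ?_)
    exact congrArg (fun g : X.1 →ₗ[F] F => g ⟨x, hx⟩) h
  have h1 := sum_comp_linearMap f κ
  have h2 : LinearMap.range f = ⊤ := LinearMap.range_eq_top.2 (LinearMap.surjective hf0)
  have h3 := Module.Dual.finrank_ker_add_one_of_ne_zero (f := f) hf0
  rw [hB.finrank_generator] at h3
  have h4 : ∑ x : X.1, κ (B x y) = ∑ x, κ (f x) := rfl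
  rw [h4, h1, ← h3, pow_succ]
  simp only [h2, Submodule.mem_top, Finset.filter_true]
  ring

open Classical in
theorem IsSymplectic.sum_sup [Fintype V] (hB : IsSymplectic B n) (X Y : Generator B) (g : V → ℝ) :
    (Fintype.card F : ℝ) ^ genDist X Y * ∑ x : X.1, ∑ y : Y.1, g (x + y) =
      (Fintype.card F : ℝ) ^ n * ∑ v with v ∈ X.1 ⊔ Y.1, g v := by
  set f : X.1 × Y.1 →ₗ[F] V := X.1.subtype.coprod Y.1.subtype with hf
  have h1 := sum_comp_linearMap f g
  have h2 : LinearMap.range f = X.1 ⊔ Y.1 := by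
    rw [hf, LinearMap.range_coprod, Submodule.range_subtype, Submodule.range_subtype]
  have h3 := LinearMap.finrank_range_add_finrank_ker f
  rw [h2, hB.finrank_sup, finrank_prod, hB.finrank_generator, hB.finrank_generator] at h3
  have h4 : genDist X Y + finrank F (LinearMap.ker f) = n := by omega
  have h5 : ∑ x : X.1, ∑ y : Y.1, g (x + y) = ∑ u, g (f u) := by
    rw [Fintype.sum_prod_type]; rfl
  rw [h5, h1]
  simp only [h2]
  rw [← mul_assoc, ← pow_add, h4]

theorem IsTriangleIndex.throughSum_away (hB : IsSymplectic B n)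
    {τ : Generator B → Generator B → ℝ} {ψ : F → ℝ} (hτ : IsTriangleIndex B τ ψ)
    {X Y : Generator B} {v : V} (hv : v ∉ X.1 ⊔ Y.1) (j : ℕ) :
    throughSum X (fun Z => τ X Z * signedDist τ j Z Y) v =
      τ X Y * if j = genDist X Y + 1 then 1 else 0 := by
  have hvX : v ∉ X.1 := fun h => hv (Submodule.mem_sup_left h)
  obtain ⟨Z, h1, h2, h3⟩ := hB.exists_throughSum_eq hvX fun Z => τ X Z * signedDist τ j Z Y
  rw [hB.mem_sup_iff] at hv
  push Not at hv
  obtain ⟨u, hu, huv⟩ := hv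
  obtain ⟨h4, h5⟩ := hτ.away hvX h2 h1 hu huv
  rw [h3, signedDist, Matrix.of_apply, h4, ← h5]
  by_cases hj : j = genDist X Y + 1
  · simp [hj]
  · simp [hj, Ne.symm hj]

theorem IsTriangleIndex.throughSum_add (hB : IsSymplectic B n)
    {τ : Generator B → Generator B → ℝ} {ψ : F → ℝ} (hτ : IsTriangleIndex B τ ψ)
    {X Y : Generator B} {x y : V} (hx : x ∈ X.1) (hy : y ∈ Y.1) (hyX : y ∉ X.1) (j : ℕ)
    [DecidableEq F] :
    throughSum X (fun Z => τ X Z * signedDist τ j Z Y) (x + y) =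
      τ X Y * ((if B x y = 0 then if j + 1 = genDist X Y then 1 else 0 else 0) +
        (if j = genDist X Y then 1 else 0) * ψ (B x y)) := by
  have hvX : x + y ∉ X.1 := fun h => hyX ((Submodule.add_mem_iff_right _ hx).1 h)
  obtain ⟨Z, h1, h2, h3⟩ := hB.exists_throughSum_eq hvX fun Z => τ X Z * signedDist τ j Z Y
  rw [h3, signedDist, Matrix.of_apply]
  by_cases hxy : B x y = 0
  · obtain ⟨h4, h5⟩ := hτ.toward hx hy hyX hxy h2 h1
    rw [hxy, hτ.zero, h4, if_pos rfl, mul_zero, add_zero, ← h5]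
    by_cases hj : genDist Z Y = j
    · simp [hj]
    · simp [hj, Ne.symm hj]
  · obtain ⟨h4, h5⟩ := hτ.level hx hy hxy h2 h1
    rw [h4, if_neg hxy, zero_add]
    by_cases hj : genDist X Y = j
    · simp [hj, h5]
    · simp [hj, Ne.symm hj]

/-- The sum over neighbours Z of X is rewritten as a sum over vectors v outside X. The vectors
outside X + Y, q^(2n) - q^(n+m) in number, all lead away from Y. The others are written x + y with y
outside X, and for fixed y the equidistribution of B x y leaves only the value at 0 and the sum of
ψ. -/
theorem IsTriangleIndex.mul_apply (hB : IsSymplectic B n)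
    {τ : Generator B → Generator B → ℝ} {ψ : F → ℝ} (hτ : IsTriangleIndex B τ ψ)
    (X Y : Generator B) (j : ℕ) :
    ((Fintype.card F : ℝ) - 1) * (signedDist τ 1 * signedDist τ j) X Y = τ X Y *
      ((if j = genDist X Y + 1 then 1 else 0) *
          ((Fintype.card F : ℝ) ^ (n + 1) - (Fintype.card F : ℝ) ^ (genDist X Y + 1)) +
        ((Fintype.card F : ℝ) ^ genDist X Y - 1) * ((if j + 1 = genDist X Y then 1 else 0) +
          (if j = genDist X Y then 1 else 0) * ∑ t, ψ t)) := by
  classical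
  have : Fintype V := Fintype.ofFinite V
  set q : ℝ := (Fintype.card F : ℝ) with hq
  have hq0 : 0 < q := by rw [hq]; exact_mod_cast Fintype.card_pos
  set m := genDist X Y with hm
  set g : Generator B → ℝ := fun Z => τ X Z * signedDist τ j Z Y with hg
  have hS : (signedDist τ 1 * signedDist τ j) X Y =
      ∑ Z : Generator B, if genDist X Z = 1 then g Z else 0 := by
    rw [Matrix.mul_apply]
    refine Finset.sum_congr rfl fun Z _ => ?_
    rw [signedDist, Matrix.of_apply, ite_mul, zero_mul]
  have hW := hB.sum_throughSum X g
  rw [← hS, ← hq] at hW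
  have hsplit : ∑ v with v ∉ X.1, throughSum X g v =
      ∑ v with v ∉ X.1 ⊔ Y.1, throughSum X g v +
        ∑ v with v ∈ X.1 ⊔ Y.1, if v ∉ X.1 then throughSum X g v else 0 := by
    rw [Finset.sum_filter, Finset.sum_filter, Finset.sum_filter, ← Finset.sum_add_distrib]
    refine Finset.sum_congr rfl fun v _ => ?_
    by_cases h1 : v ∈ X.1 ⊔ Y.1
    · simp [h1]
    · have h2 : v ∉ X.1 := fun h => h1 (Submodule.mem_sup_left h)
      simp [h1, h2]
  have h1 : ∑ v with v ∉ X.1 ⊔ Y.1, throughSum X g v =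
      (q ^ (2 * n) - q ^ (n + m)) * (τ X Y * if j = m + 1 then 1 else 0) := by
    rw [Finset.sum_congr rfl fun v hv =>
      hτ.throughSum_away hB (Finset.mem_filter.1 hv).2 j, Finset.sum_const, nsmul_eq_mul]
    congr 1
    have h := card_filter_mem_not_mem (⊤ : Submodule F V) (X.1 ⊔ Y.1)
    rw [finrank_top, top_inf_eq, hB.dim, hB.finrank_sup] at h
    rw [← h]
    congr 2
    ext v
    simp
  -- With τ X Y factored out, κ t is the contribution of the neighbour through x + y when B x y = t.
  set κ : F → ℝ := fun t => (if t = 0 then if j + 1 = m then 1 else 0 else 0) +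
    (if j = m then 1 else 0) * ψ t with hκ
  have hκsum : ∑ t, κ t = (if j + 1 = m then 1 else 0) + (if j = m then 1 else 0) * ∑ t, ψ t := by
    rw [hκ, Finset.sum_add_distrib, ← Finset.mul_sum, Finset.sum_ite_eq' Finset.univ (0 : F),
      if_pos (Finset.mem_univ _)]
  have h2 : q ^ (n + 1) * ∑ v with v ∈ X.1 ⊔ Y.1, (if v ∉ X.1 then throughSum X g v else 0) =
      q ^ n * (q ^ n * (q ^ m - 1)) * (τ X Y * ∑ t, κ t) := by
    rw [pow_succ', mul_assoc, ← hB.sum_sup X Y, ← hm, ← hq, Finset.sum_comm]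
    have hinner : ∀ y : Y.1, q * ∑ x : X.1,
        (if ((x : V) + (y : V)) ∉ X.1 then throughSum X g (x + y) else 0) =
        if (y : V) ∉ X.1 then q ^ n * (τ X Y * ∑ t, κ t) else 0 := by
      intro y
      by_cases hy : (y : V) ∈ X.1
      · rw [if_neg (not_not.2 hy), Finset.sum_eq_zero, mul_zero]
        intro x _
        exact if_neg (not_not.2 (X.1.add_mem x.2 hy))
      · rw [if_pos hy, show q ^ n * (τ X Y * ∑ t, κ t) = τ X Y * (q ^ n * ∑ t, κ t) by ring, hq,
          ← hB.sum_form X hy κ, ← hq, mul_left_comm,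
          Finset.mul_sum _ _ (τ X Y)]
        congr 1
        refine Finset.sum_congr rfl fun x _ => ?_
        have hxy : (x : V) + (y : V) ∉ X.1 := fun h =>
          hy ((X.1.add_mem_iff_right x.2).1 h)
        rw [if_pos hxy]
        exact hτ.throughSum_add hB x.2 y.2 hy j
    rw [mul_left_comm, Finset.mul_sum, Finset.sum_congr rfl fun y _ => hinner y, ← Finset.sum_filter,
      Finset.sum_const, nsmul_eq_mul]
    have hcard : q ^ m * (((Finset.univ.filter fun y : Y.1 => (y : V) ∉ X.1).card : ℕ) : ℝ) =
        q ^ n * (q ^ m - 1) := by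
      have h := card_filter_mem_not_mem Y.1 X.1
      have h3 := hB.genDist_add_finrank X Y
      rw [inf_comm] at h3
      rw [hB.finrank_generator, ← hq] at h
      have h4 : (Finset.univ.filter fun y : Y.1 => (y : V) ∉ X.1).card =
          (Finset.univ.filter fun v => v ∈ Y.1 ∧ v ∉ X.1).card := by
        rw [← Fintype.card_subtype, ← Fintype.card_subtype]
        exact Fintype.card_congr (Equiv.subtypeSubtypeEquivSubtypeInter
          (fun v => v ∈ Y.1) fun v => v ∉ X.1)
      rw [h4, h, ← h3, ← hm]
      ring
    rw [← mul_assoc, hcard]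
    ring
  have hqn : q ^ n * q ^ n ≠ 0 := by positivity
  have hqn' : q ^ n ≠ 0 := by positivity
  rw [← hκsum, ← mul_right_inj' hqn]
  rw [hsplit, h1] at hW
  have e1 : q ^ (2 * n) = q ^ n * q ^ n := by rw [two_mul, pow_add]
  rw [e1] at hW
  simp only [pow_add, pow_one] at hW h2 ⊢
  linear_combination (-q ^ n) * hW + h2

variable [DecidableEq (Generator B)]

theorem IsTriangleIndex.isRecurrent (hB : IsSymplectic B n)
    {τ : Generator B → Generator B → ℝ} {ψ : F → ℝ} (hτ : IsTriangleIndex B τ ψ) {a b : ℝ}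
    (hψ : ∑ t, ψ t = a - b) : IsRecurrent (Fintype.card F : ℝ) a b n (signedDist τ) where
  zero := by
    ext X Y
    rw [signedDist, Matrix.of_apply, Matrix.one_apply]
    by_cases h : X = Y
    · subst h
      simp [hB.genDist_eq_zero, hτ.self]
    · simp [hB.genDist_eq_zero, h]
  last := by
    ext X Y
    have := hB.genDist_le X Y
    rw [signedDist, Matrix.of_apply, if_neg (by omega), Matrix.zero_apply]
  orth := by
    intro j k hjk
    rw [Matrix.trace]
    refine Finset.sum_eq_zero fun X _ => ?_
    rw [Matrix.diag_apply, Matrix.mul_apply]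
    refine Finset.sum_eq_zero fun Y _ => ?_
    rw [signedDist, signedDist, Matrix.of_apply, Matrix.of_apply, hB.genDist_comm Y X]
    split_ifs with h1 h2
    · exact absurd (h1.symm.trans h2) hjk
    all_goals simp
  step := by
    intro k
    ext X Y
    have h := hτ.mul_apply hB X Y (k + 1)
    simp only [Matrix.smul_apply, Matrix.add_apply, smul_eq_mul]
    rw [h, hψ]
    simp only [signedDist, Matrix.of_apply]
    generalize genDist X Y = m
    by_cases h0 : m = k
    · subst h0
      rw [if_pos rfl, if_neg (by omega), if_neg (by omega), if_pos rfl, if_neg (by omega),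
        if_neg (by omega)]
      ring
    by_cases h1 : m = k + 1
    · subst h1
      rw [if_neg (by omega), if_neg (by omega), if_pos rfl, if_neg (by omega), if_pos rfl,
        if_neg (by omega)]
      ring
    by_cases h2 : m = k + 2
    · subst h2
      rw [if_neg (by omega), if_pos rfl, if_neg (by omega), if_neg (by omega), if_neg (by omega),
        if_pos rfl]
      ring
    · rw [if_neg (by omega), if_neg (by omega), if_neg (by omega), if_neg h0, if_neg h1, if_neg h2]
      ring

end Counting

/-! ### The unsigned and the signed triangle index. -/

section Instances

variable {F : Type*} [Field F] [Fintype F] [DecidableEq F] {V : Type*} [AddCommGroup V] [Module F V]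
  [Finite V] {B : LinearMap.BilinForm F V} {n : ℕ} {δ : ∀ X : Generator B, X.1 [⋀^Fin n]→ₗ[F] F}

theorem isTriangleIndex_maslovIndex (hB : IsSymplectic B n) (hq : Fintype.card F % 4 = 1)
    (hδ : ∀ X, δ X ≠ 0) :
    IsTriangleIndex B (fun X Y => (maslovIndex δ X Y : ℝ)) fun t => (quadraticChar F t : ℝ) where
  sq X Y := by rw [← sq]; exact_mod_cast maslovIndex_sq hδ hB
  self X := by exact_mod_cast maslovIndex_self hδ hB
  comm X Y := by rw [maslovIndex_comm hB hq]
  zero := by simp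
  away h1 h2 h3 h4 h5 := by
    obtain ⟨h, h'⟩ := maslovIndex_away hB hq hδ h1 h2 h3 h4 h5
    exact ⟨h, by exact_mod_cast h'⟩
  level h1 h2 h3 h4 h5 := by
    obtain ⟨h, h'⟩ := maslovIndex_level hB hδ h1 h2 h3 h4 h5
    exact ⟨h, by exact_mod_cast h'⟩
  toward h1 h2 h3 h4 h5 h6 := by
    obtain ⟨h, h'⟩ := maslovIndex_toward hB hq hδ h1 h2 h3 h4 h5 h6
    exact ⟨h, by exact_mod_cast h'⟩

/-- Only the distance statements of the triangle lemmas are used; the defect is the indicator of the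
nonzero scalars, with sum q - 1. -/
theorem isTriangleIndex_one (hB : IsSymplectic B n) (hq : Fintype.card F % 4 = 1)
    (hδ : ∀ X, δ X ≠ 0) :
    IsTriangleIndex B (fun _ _ => 1) fun t => if t = 0 then 0 else 1 where
  sq X Y := one_mul 1
  self X := rfl
  comm X Y := rfl
  zero := if_pos rfl
  away h1 h2 h3 h4 h5 := ⟨(maslovIndex_away hB hq hδ h1 h2 h3 h4 h5).1, one_mul 1⟩
  level h1 h2 h3 h4 h5 := ⟨(maslovIndex_level hB hδ h1 h2 h3 h4 h5).1, by rw [if_neg h3]⟩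
  toward h1 h2 h3 h4 h5 h6 := ⟨(maslovIndex_toward hB hq hδ h1 h2 h3 h4 h5 h6).1, one_mul 1⟩

theorem sum_quadraticChar (hq : Fintype.card F % 4 = 1) :
    ∑ t, (quadraticChar F t : ℝ) = 0 := by
  have hchar : ringChar F ≠ 2 := by
    intro h
    have := FiniteField.even_card_of_char_two h
    omega
  exact_mod_cast quadraticChar_sum_zero hchar

theorem sum_ite_zero : ∑ t : F, (if t = 0 then (0 : ℝ) else 1) = Fintype.card F - 1 := by
  rw [Finset.sum_ite, Finset.sum_const_zero, zero_add, Finset.sum_const, nsmul_eq_mul, mul_one,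
    Finset.filter_ne', Finset.card_erase_of_mem (Finset.mem_univ _), Finset.card_univ,
    Nat.cast_sub Fintype.card_pos, Nat.cast_one]

end Instances

/-! ### Association schemes from orthogonal idempotents -/

section Scheme

variable {Ω : Type*} [Fintype Ω] {d : ℕ} {R : Fin (d + 1) → Ω → Ω → Prop}
  {E : Fin (d + 1) → Matrix Ω Ω ℝ} {P : Matrix (Fin (d + 1)) (Fin (d + 1)) ℝ}

theorem sum_smul_adjMatrix_apply (hpart : ∀ x y, ∃! i, R i x y) (c : Fin (d + 1) → ℝ)
    {k : Fin (d + 1)} {x y : Ω} (hk : R k x y) : (∑ j, c j • adjMatrix R j) x y = c k := by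
  rw [Matrix.sum_apply, Finset.sum_eq_single k]
  · simp [adjMatrix, hk]
  · intro j _ hj
    have : ¬R j x y := fun h => hj ((hpart x y).unique h hk)
    simp [adjMatrix, this]
  · simp

theorem linearIndependent_adjMatrix (hpart : ∀ x y, ∃! i, R i x y)
    (hne : ∀ i, ∃ x y, R i x y) : LinearIndependent ℝ (adjMatrix R) := by
  rw [Fintype.linearIndependent_iff]
  intro g hg k
  obtain ⟨x, y, hk⟩ := hne k
  rw [← sum_smul_adjMatrix_apply hpart g hk, hg, Matrix.zero_apply]

theorem mul_sum_smul_idempotent (hE : ∀ i j, E i * E j = if i = j then E i else 0)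
    (c : Fin (d + 1) → ℝ) (i : Fin (d + 1)) : E i * ∑ j, c j • E j = c i • E i := by
  simp [Finset.mul_sum, hE]

theorem sum_smul_idempotent_mul (hE : ∀ i j, E i * E j = if i = j then E i else 0)
    (c : Fin (d + 1) → ℝ) (i : Fin (d + 1)) : (∑ j, c j • E j) * E i = c i • E i := by
  simp [Finset.sum_mul, hE]

/-- The independent A j are combinations of equally many E i, so the E i are a basis of the
Bose-Mesner algebra. Orthogonality forces the coefficients of any idempotent to be 0 or 1, hence
exactly the E i are primitive. -/
theorem isIdempotentOrdering_of_orthogonal (hpart : ∀ x y, ∃! i, R i x y)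
    (hne : ∀ i, ∃ x y, R i x y) (hE : ∀ i j, E i * E j = if i = j then E i else 0)
    (hP : IsPMatrix R E P) : IsIdempotentOrdering R E := by
  obtain ⟨hli, hspan⟩ := linearIndependent_and_span_eq_of_eq_sum
    (linearIndependent_adjMatrix hpart hne) (E := E) (P := fun i j => P i j) hP
  have hbm : boseMesner R = Submodule.span ℝ (Set.range E) := hspan
  have hmem : ∀ i, E i ∈ boseMesner R := fun i => by
    rw [hbm]; exact Submodule.subset_span ⟨i, rfl⟩
  have hidem : ∀ i, E i * E i = E i := fun i => by rw [hE, if_pos rfl]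
  have hcoef : ∀ {f : Matrix Ω Ω ℝ} {c : Fin (d + 1) → ℝ}, ∑ j, c j • E j = f → f * f = f →
      ∀ i, c i = 0 ∨ c i = 1 := by
    intro f c hc hf i
    have hfi : f * E i = c i • E i := by rw [← hc, sum_smul_idempotent_mul hE]
    have h1 : (c i * c i) • E i = c i • E i := by
      rw [← smul_smul, ← hfi, ← mul_smul_comm, ← hfi, ← mul_assoc, hf]
    have h2 := smul_left_injective ℝ (hli.ne_zero i) h1
    have h3 : c i * (c i - 1) = 0 := by rw [mul_sub, h2, mul_one, sub_self]
    rcases mul_eq_zero.1 h3 with h | h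
    · exact Or.inl h
    · exact Or.inr (sub_eq_zero.1 h)
  refine ⟨hli.injective, fun e => ⟨?_, fun he => ?_⟩⟩
  · rintro ⟨i, rfl⟩
    refine ⟨hmem i, hidem i, hli.ne_zero i, fun f hf hff hEf _ => ?_⟩
    rw [hbm] at hf
    obtain ⟨c, hc⟩ := (Submodule.mem_span_range_iff_exists_fun ℝ).1 hf
    rw [← hc, mul_sum_smul_idempotent hE, hc] at hEf
    rcases hcoef hc hff i with h | h
    · left; rw [← hEf, h, zero_smul]
    · right; rw [← hEf, h, one_smul]
  · have hme := he.mem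
    rw [hbm] at hme
    obtain ⟨c, hc⟩ := (Submodule.mem_span_range_iff_exists_fun ℝ).1 hme
    obtain ⟨i, hi⟩ : ∃ i, c i ≠ 0 := by
      by_contra! hcon
      refine he.ne_zero ?_
      rw [← hc]
      exact Finset.sum_eq_zero fun i _ => by rw [hcon, zero_smul]
    have hi1 := (hcoef hc he.idem i).resolve_left hi
    have h1 : e * E i = E i := by rw [← hc, sum_smul_idempotent_mul hE, hi1, one_smul]
    have h2 : E i * e = E i := by rw [← hc, mul_sum_smul_idempotent hE, hi1, one_smul]
    exact ⟨i, (he.minimal _ (hmem i) (hidem i) h1 h2).resolve_left (hli.ne_zero i)⟩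

theorem adjMatrix_mul_apply (i j : Fin (d + 1)) (x y : Ω) :
    (adjMatrix R i * adjMatrix R j) x y = (Nat.card {z : Ω // R i x z ∧ R j z y} : ℝ) := by
  classical
  rw [Matrix.mul_apply, Nat.card_eq_fintype_card, Fintype.card_subtype, Finset.card_filter,
    Nat.cast_sum]
  refine Finset.sum_congr rfl fun z _ => ?_
  by_cases h1 : R i x z <;> by_cases h2 : R j z y <;> simp [adjMatrix, h1, h2]

/-- The span is closed under multiplication, so A_i A_j is constant on every relation, and its
entries are the counts in question. -/
theorem exists_intersection_of_orthogonal (hpart : ∀ x y, ∃! i, R i x y)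
    (hne : ∀ i, ∃ x y, R i x y) (hE : ∀ i j, E i * E j = if i = j then E i else 0)
    (hP : IsPMatrix R E P) : ∃ p : Fin (d + 1) → Fin (d + 1) → Fin (d + 1) → ℕ,
      ∀ i j k x y, R k x y → Nat.card {z : Ω // R i x z ∧ R j z y} = p i j k := by
  obtain ⟨-, hspan⟩ := linearIndependent_and_span_eq_of_eq_sum
    (linearIndependent_adjMatrix hpart hne) (E := E) (P := fun i j => P i j) hP
  choose x₀ y₀ h₀ using hne
  refine ⟨fun i j k => Nat.card {z : Ω // R i (x₀ k) z ∧ R j z (y₀ k)}, fun i j k x y hk => ?_⟩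
  have hmem : adjMatrix R i * adjMatrix R j ∈ Submodule.span ℝ (Set.range (adjMatrix R)) := by
    rw [hspan, hP i, Finset.sum_mul]
    refine Submodule.sum_mem _ fun l _ => ?_
    rw [smul_mul_assoc, hP j, mul_sum_smul_idempotent hE]
    exact Submodule.smul_mem _ _ (Submodule.smul_mem _ _ (Submodule.subset_span ⟨l, rfl⟩))
  obtain ⟨c, hc⟩ := (Submodule.mem_span_range_iff_exists_fun ℝ).1 hmem
  have h1 := adjMatrix_mul_apply (R := R) i j x y
  have h2 := adjMatrix_mul_apply (R := R) i j (x₀ k) (y₀ k)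
  rw [← hc, sum_smul_adjMatrix_apply hpart c hk] at h1
  rw [← hc, sum_smul_adjMatrix_apply hpart c (h₀ k)] at h2
  exact_mod_cast h1.symm.trans h2

end Scheme

/-! ### The double cover -/

section Lift

variable {Ω : Type*}

/-- The matrix on the double cover that is constant on fibres. -/
def liftEven (M : Matrix Ω Ω ℝ) : Matrix (Ω × ℤˣ) (Ω × ℤˣ) ℝ :=
  Matrix.of fun u v => M u.1 v.1 / 2

/-- The matrix on the double cover that changes sign on fibres. -/
def liftOdd (M : Matrix Ω Ω ℝ) : Matrix (Ω × ℤˣ) (Ω × ℤˣ) ℝ :=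
  Matrix.of fun u v => (((u.2 * v.2 : ℤˣ) : ℤ) : ℝ) * M u.1 v.1 / 2

theorem liftEven_sum {ι : Type*} (s : Finset ι) (c : ι → ℝ) (M : ι → Matrix Ω Ω ℝ) :
    liftEven (∑ i ∈ s, c i • M i) = ∑ i ∈ s, c i • liftEven (M i) := by
  ext u v
  simp [liftEven, Matrix.sum_apply, Finset.sum_div, mul_div_assoc]

theorem liftOdd_sum {ι : Type*} (s : Finset ι) (c : ι → ℝ) (M : ι → Matrix Ω Ω ℝ) :
    liftOdd (∑ i ∈ s, c i • M i) = ∑ i ∈ s, c i • liftOdd (M i) := by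
  ext u v
  simp only [liftOdd, Matrix.of_apply, Matrix.sum_apply, Matrix.smul_apply, smul_eq_mul,
    Finset.mul_sum, Finset.sum_div]
  exact Finset.sum_congr rfl fun i _ => by ring

theorem sum_intUnits (f : ℤˣ → ℝ) : ∑ e, f e = f 1 + f (-1) := by
  rw [show (Finset.univ : Finset ℤˣ) = {1, -1} from rfl, Finset.sum_pair (by decide)]

variable [Fintype Ω]

/-- Summing over the two points of a fibre gives a factor 2, which the normalization by 1/2 absorbs;
in the mixed products below the two points cancel. -/
theorem liftEven_mul (M N : Matrix Ω Ω ℝ) : liftEven M * liftEven N = liftEven (M * N) := by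
  ext u v
  simp only [liftEven, Matrix.mul_apply, Matrix.of_apply, Fintype.sum_prod_type, Finset.sum_div]
  refine Finset.sum_congr rfl fun z _ => ?_
  rw [sum_intUnits]; ring

theorem liftOdd_mul (M N : Matrix Ω Ω ℝ) : liftOdd M * liftOdd N = liftOdd (M * N) := by
  ext u v
  simp only [liftOdd, Matrix.mul_apply, Matrix.of_apply, Fintype.sum_prod_type, Finset.sum_div,
    Finset.mul_sum]
  refine Finset.sum_congr rfl fun z _ => ?_
  rw [sum_intUnits]
  push_cast
  ring

theorem liftEven_mul_liftOdd (M N : Matrix Ω Ω ℝ) : liftEven M * liftOdd N = 0 := by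
  ext u v
  simp only [liftEven, liftOdd, Matrix.mul_apply, Matrix.of_apply, Fintype.sum_prod_type,
    Matrix.zero_apply]
  refine Finset.sum_eq_zero fun z _ => ?_
  rw [sum_intUnits]
  push_cast
  ring

theorem liftOdd_mul_liftEven (M N : Matrix Ω Ω ℝ) : liftOdd M * liftEven N = 0 := by
  ext u v
  simp only [liftEven, liftOdd, Matrix.mul_apply, Matrix.of_apply, Fintype.sum_prod_type,
    Matrix.zero_apply]
  refine Finset.sum_eq_zero fun z _ => ?_
  rw [sum_intUnits]
  push_cast
  ring

/-- The matrices lifted from `M` and `N`, alternately. -/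
def liftAlt (M N : ℕ → Matrix Ω Ω ℝ) (i : ℕ) : Matrix (Ω × ℤˣ) (Ω × ℤˣ) ℝ :=
  if Even i then liftEven (M (i / 2)) else liftOdd (N (i / 2))

theorem liftAlt_mul {M N : ℕ → Matrix Ω Ω ℝ} {n : ℕ}
    (hM : ∀ i j, i ≤ n → j ≤ n → M i * M j = if i = j then M i else 0)
    (hN : ∀ i j, i ≤ n → j ≤ n → N i * N j = if i = j then N i else 0) {i j : ℕ}
    (hi : i < 2 * n + 2) (hj : j < 2 * n + 2) :
    liftAlt M N i * liftAlt M N j = if i = j then liftAlt M N i else 0 := by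
  have hE0 : liftEven (0 : Matrix Ω Ω ℝ) = 0 := by ext u v; simp [liftEven]
  have hO0 : liftOdd (0 : Matrix Ω Ω ℝ) = 0 := by ext u v; simp [liftOdd]
  by_cases hij : i = j
  · subst hij
    rw [if_pos rfl, liftAlt]
    split_ifs with h
    · rw [liftEven_mul, hM _ _ (by omega) (by omega), if_pos rfl]
    · rw [liftOdd_mul, hN _ _ (by omega) (by omega), if_pos rfl]
  · rw [if_neg hij, liftAlt, liftAlt]
    split_ifs with h1 h2 h2
    · rw [Nat.even_iff] at h1 h2
      rw [liftEven_mul, hM _ _ (by omega) (by omega), if_neg (by omega), hE0]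
    · exact liftEven_mul_liftOdd _ _
    · exact liftOdd_mul_liftEven _ _
    · rw [Nat.even_iff] at h1 h2
      rw [liftOdd_mul, hN _ _ (by omega) (by omega), if_neg (by omega), hO0]

end Lift

theorem sum_range_two_mul {M : Type*} [AddCommMonoid M] (f : ℕ → M) (N : ℕ) :
    ∑ i ∈ Finset.range (2 * N), f i =
      ∑ m ∈ Finset.range N, f (2 * m) + ∑ m ∈ Finset.range N, f (2 * m + 1) := by
  induction N with
  | zero => simp
  | succ N ih =>
    rw [show 2 * (N + 1) = 2 * N + 1 + 1 by ring, Finset.sum_range_succ, Finset.sum_range_succ, ih,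
      Finset.sum_range_succ, Finset.sum_range_succ]
    abel

/-- The distance that belongs to the relation with index `j`. -/
def foldIndex (n j : ℕ) : ℕ := if j ≤ n then j else 2 * n + 1 - j

/-- The sign that belongs to the relation with index `j`. -/
def foldSign (n j : ℕ) : ℤ := if j ≤ n then 1 else -1

/-- The `P`-matrix of the double cover. -/
def coverP (q : ℝ) (n i j : ℕ) : ℝ :=
  if Even i then pEntry q q 1 n (i / 2) (foldIndex n j)
  else (foldSign n j : ℝ) * pEntry q (Real.sqrt q) (Real.sqrt q) n (i / 2) (foldIndex n j)

/-! ### The relations of the double cover. -/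

section Cover

variable {F : Type*} [Field F] [Fintype F] [DecidableEq F] {V : Type*} [AddCommGroup V] [Module F V]
  {B : LinearMap.BilinForm F V} {n : ℕ} {δ : ∀ X : Generator B, X.1 [⋀^Fin n]→ₗ[F] F}

theorem coverRel_iff (i : Fin (2 * n + 1 + 1)) (u v : CoverVertex B) :
    coverRel δ i u v ↔ genDist u.1 v.1 = foldIndex n i ∧
      ((u.2 * v.2 : ℤˣ) : ℤ) = foldSign n i * maslovIndex δ u.1 v.1 := by
  rw [coverRel, foldIndex, foldSign]
  split_ifs <;> simp

variable [Finite V]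

theorem maslovIndex_eq_one_or (hB : IsSymplectic B n) (hδ : ∀ X, δ X ≠ 0) (X Y : Generator B) :
    maslovIndex δ X Y = 1 ∨ maslovIndex δ X Y = -1 :=
  mul_self_eq_one_iff.1 (by rw [← sq]; exact maslovIndex_sq hδ hB)

theorem coverRel_existsUnique (hB : IsSymplectic B n) (hδ : ∀ X, δ X ≠ 0) (u v : CoverVertex B) :
    ∃! i, coverRel δ i u v := by
  have hd := hB.genDist_le u.1 v.1
  simp only [coverRel_iff, foldIndex, foldSign]
  generalize genDist u.1 v.1 = m at hd
  have hσ := maslovIndex_eq_one_or hB hδ u.1 v.1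
  generalize maslovIndex δ u.1 v.1 = s at hσ
  have he : ((u.2 * v.2 : ℤˣ) : ℤ) = 1 ∨ ((u.2 * v.2 : ℤˣ) : ℤ) = -1 := by
    rcases Int.units_eq_one_or (u.2 * v.2) with h | h <;> simp [h]
  generalize ((u.2 * v.2 : ℤˣ) : ℤ) = e at he
  by_cases hes : e = s
  · refine ⟨⟨m, by omega⟩, ⟨by simp [hd], by simp [hd, hes]⟩, ?_⟩
    rintro ⟨i, hi⟩ ⟨h1, h2⟩
    dsimp only at h1 h2
    ext
    dsimp only
    split_ifs at h1 h2 <;> omega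
  · refine ⟨⟨2 * n + 1 - m, by omega⟩, ⟨?_, ?_⟩, ?_⟩
    · dsimp only; rw [if_neg (by omega)]; omega
    · dsimp only; rw [if_neg (by omega)]; omega
    · rintro ⟨i, hi⟩ ⟨h1, h2⟩
      dsimp only at h1 h2
      ext
      dsimp only
      split_ifs at h1 h2 <;> omega

theorem coverRel_symm (hB : IsSymplectic B n) (hq : Fintype.card F % 4 = 1)
    (i : Fin (2 * n + 1 + 1)) (u v : CoverVertex B) (h : coverRel δ i u v) :
    coverRel δ i v u := by
  rw [coverRel_iff] at h ⊢
  rw [hB.genDist_comm, maslovIndex_comm hB hq, mul_comm v.2]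
  exact h

theorem coverRel_zero (hB : IsSymplectic B n) (hδ : ∀ X, δ X ≠ 0) (u v : CoverVertex B) :
    coverRel δ 0 u v ↔ u = v := by
  rw [coverRel_iff]
  obtain ⟨X, e⟩ := u
  obtain ⟨Y, e'⟩ := v
  simp only [foldIndex, foldSign, Fin.val_zero, Nat.zero_le, if_true, one_mul,
    hB.genDist_eq_zero, Prod.mk.injEq]
  refine and_congr_right fun h => ?_
  subst h
  rw [maslovIndex_self hδ hB]
  rcases Int.units_eq_one_or e with rfl | rfl <;> rcases Int.units_eq_one_or e' with rfl | rfl <;>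
    simp

/-- For signs e and s, the indicator of e = sσ is (1 + s e σ)/2. -/
theorem adjMatrix_coverRel (hB : IsSymplectic B n) (hδ : ∀ X, δ X ≠ 0)
    (j : Fin (2 * n + 1 + 1)) : adjMatrix (coverRel δ) j =
      liftEven (signedDist (fun _ _ => 1) (foldIndex n j)) + (foldSign n j : ℝ) •
        liftOdd (signedDist (fun X Y => (maslovIndex δ X Y : ℝ)) (foldIndex n j)) := by
  ext u v
  rw [adjMatrix, Matrix.of_apply, coverRel_iff]
  simp only [Matrix.add_apply, Matrix.smul_apply, liftEven, liftOdd, signedDist, Matrix.of_apply,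
    smul_eq_mul]
  by_cases hd : genDist u.1 v.1 = foldIndex n j
  · simp only [hd, true_and, if_true]
    have hs : foldSign n j = 1 ∨ foldSign n j = -1 := by
      rw [foldSign]; split_ifs <;> simp
    rcases hs with hs | hs <;>
    rcases maslovIndex_eq_one_or hB hδ u.1 v.1 with hσ | hσ <;>
    rcases Int.units_eq_one_or (u.2 * v.2) with he | he <;>
    rw [hs, hσ, he] <;> norm_num
  · simp [hd]

theorem coverRel_nonempty (hB : IsSymplectic B n) (hq : Fintype.card F % 4 = 1)
    (hδ : ∀ X, δ X ≠ 0) (i : Fin (2 * n + 1 + 1)) : ∃ u v, coverRel δ i u v := by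
  classical
  have hk : foldIndex n i ≤ n := by
    have := i.2
    rw [foldIndex]; split_ifs <;> omega
  have hcard : (1 : ℝ) < Fintype.card F := by exact_mod_cast Fintype.one_lt_card
  have hrec : IsRecurrent (Fintype.card F : ℝ) (Fintype.card F) 1 n (signedDist (B := B) fun _ _ => 1) :=
    (isTriangleIndex_one hB hq hδ).isRecurrent hB sum_ite_zero
  -- If the distance did not occur, its distance matrix would be zero, against the positive trace of
  -- its square.
  obtain ⟨X, Y, hXY⟩ : ∃ X Y : Generator B, genDist X Y = foldIndex n i := by
    by_contra! hcon
    have h0 : signedDist (B := B) (fun _ _ => 1) (foldIndex n i) = 0 := by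
      ext X Y
      rw [signedDist, Matrix.of_apply, if_neg (hcon X Y), Matrix.zero_apply]
    have h1 := hrec.trace_sq hcard (foldIndex n i)
    rw [h0, mul_zero, Matrix.trace_zero] at h1
    have := hB.nonempty_generator
    have h2 : (0 : ℝ) < Fintype.card (Generator B) := by exact_mod_cast Fintype.card_pos
    have h3 := gauss_pos hcard hk
    have h4 : (0 : ℝ) < Fintype.card F := by linarith
    have h5 : (0 : ℝ) < Fintype.card (Generator B) * ((Fintype.card F : ℝ) ^ foldIndex n i *
      (Fintype.card F : ℝ) ^ (foldIndex n i).choose 2 *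
        gauss (Fintype.card F : ℝ) n (foldIndex n i)) := by positivity
    linarith
  obtain ⟨e, he⟩ : ∃ e : ℤˣ, (e : ℤ) = foldSign n i * maslovIndex δ X Y := by
    have hs : foldSign n i = 1 ∨ foldSign n i = -1 := by
      rw [foldSign]; split_ifs <;> simp
    rcases hs with hs | hs <;> rcases maslovIndex_eq_one_or hB hδ X Y with hσ | hσ <;>
    rw [hs, hσ]
    · exact ⟨1, rfl⟩
    · exact ⟨-1, rfl⟩
    · exact ⟨-1, rfl⟩
    · exact ⟨1, rfl⟩
  refine ⟨(X, e), (Y, 1), (coverRel_iff i _ _).2 ⟨hXY, ?_⟩⟩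
  rw [mul_one]
  exact he

open Polynomial in
theorem degree_C_mul_comp_sq {f : ℝ[X]} {i : ℕ} (hf : f.degree = (i : WithBot ℕ)) {c t : ℝ}
    (hc : c ≠ 0) (ht : t ≠ 0) :
    (C c * f.comp (C t * X ^ 2)).degree = ((2 * i : ℕ) : WithBot ℕ) := by
  have hf0 : f ≠ 0 := by
    rintro rfl
    rw [degree_zero] at hf
    exact WithBot.bot_ne_natCast _ hf
  have hd : (C t * X ^ 2 : ℝ[X]).natDegree = 2 := natDegree_C_mul_X_pow 2 t ht
  have h0 : f.comp (C t * X ^ 2) ≠ 0 := by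
    rw [← leadingCoeff_ne_zero, leadingCoeff_comp (by rw [hd]; norm_num)]
    refine mul_ne_zero (leadingCoeff_ne_zero.2 hf0) (pow_ne_zero _ ?_)
    rwa [leadingCoeff_C_mul_X_pow]
  rw [degree_C_mul hc, degree_eq_natDegree h0, natDegree_comp, hd, natDegree_eq_of_degree_eq_some hf,
    mul_comm]

end Cover

/-! ### Idempotents of the double cover as polynomials in the first odd one. -/

theorem sum_smul_signedDist_apply {F : Type*} [Field F] {V : Type*} [AddCommGroup V] [Module F V]
    [Finite V] {B : LinearMap.BilinForm F V} {n : ℕ} (hB : IsSymplectic B n)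
    (τ : Generator B → Generator B → ℝ) (f : ℕ → ℝ) (X Y : Generator B) :
    (∑ k ∈ Finset.range (n + 1), f k • signedDist τ k) X Y = f (genDist X Y) * τ X Y := by
  rw [Matrix.sum_apply, Finset.sum_eq_single (genDist X Y)]
  · simp [signedDist]
  · intro k _ hk
    simp [signedDist, Ne.symm hk]
  · intro h
    exact absurd (Finset.mem_range.2 (Nat.lt_succ_of_le (hB.genDist_le X Y))) h

open Polynomial in
/-- The entries of the even idempotents are even polynomials in the entries of the first odd one,
and those of the odd idempotents are odd polynomials. -/
theorem exists_polynomial_liftAlt {F : Type*} [Field F] {V : Type*} [AddCommGroup V] [Module F V]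
    [Finite V] {B : LinearMap.BilinForm F V} {n : ℕ} (hB : IsSymplectic B n)
    {σ : Generator B → Generator B → ℝ} (hσ : ∀ X Y, σ X Y * σ X Y = 1) {q r : ℝ} (hr : r ≠ 0)
    (hrq : r * r = q) {M N : ℕ → Matrix (Generator B) (Generator B) ℝ} {f g : ℕ → ℝ[X]}
    (hf : ∀ i, (f i).degree = (i : WithBot ℕ)) (hg : ∀ i, (g i).degree = (i : WithBot ℕ))
    (hM : ∀ i ≤ n, ∃ c : ℝ, c ≠ 0 ∧ M i = ∑ k ∈ Finset.range (n + 1),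
      (c * (1 ^ k)⁻¹ * (f i).eval (q ^ k)⁻¹) • signedDist (fun _ _ => 1) k)
    (hN : ∀ i ≤ n, ∃ c : ℝ, c ≠ 0 ∧ N i = ∑ k ∈ Finset.range (n + 1),
      (c * (r ^ k)⁻¹ * (g i).eval (q ^ k)⁻¹) • signedDist σ k) {j : ℕ} (hj : j < 2 * n + 2) :
    ∃ p : ℝ[X], p.degree = (j : WithBot ℕ) ∧
      ∀ u v, liftAlt M N j u v = p.eval (liftAlt M N 1 u v) := by
  obtain ⟨c₀, hc₀, hN₀⟩ := hN 0 (Nat.zero_le n)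
  have hg0 : g 0 = C ((g 0).coeff 0) := eq_C_of_degree_eq_zero (hg 0)
  have hcoeff : (g 0).coeff 0 ≠ 0 := by
    intro h
    have h1 := hg 0
    rw [hg0, h, C_0, degree_zero] at h1
    exact WithBot.bot_ne_natCast _ h1
  set κ : ℝ := c₀ * (g 0).coeff 0 / 2 with hκ
  have hκ0 : κ ≠ 0 := by positivity
  have h1 : ∀ u v : Generator B × ℤˣ, liftAlt M N 1 u v =
      (((u.2 * v.2 : ℤˣ) : ℤ) : ℝ) * σ u.1 v.1 * (κ * (r ^ genDist u.1 v.1)⁻¹) := by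
    intro u v
    rw [liftAlt, if_neg (by decide), liftOdd, Matrix.of_apply, hN₀,
      sum_smul_signedDist_apply hB σ (fun k => c₀ * (r ^ k)⁻¹ * (g 0).eval (q ^ k)⁻¹), hg0, eval_C,
      hκ]
    ring
  have hunit : ∀ e : ℤˣ, ((e : ℤ) : ℝ) * ((e : ℤ) : ℝ) = 1 := by
    intro e
    rcases Int.units_eq_one_or e with rfl | rfl <;> norm_num
  -- Squaring removes the signs εε' and σ and turns r^(-d) into q^(-d), the argument of the dual
  -- polynomials.
  have h2 : ∀ u v : Generator B × ℤˣ,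
      (κ ^ 2)⁻¹ * liftAlt M N 1 u v ^ 2 = (q ^ genDist u.1 v.1)⁻¹ := by
    intro u v
    rw [h1, ← hrq, mul_pow r r]
    calc _ = (κ ^ 2)⁻¹ * κ ^ 2 * ((((u.2 * v.2 : ℤˣ) : ℤ) : ℝ) * (((u.2 * v.2 : ℤˣ) : ℤ) : ℝ)) *
          (σ u.1 v.1 * σ u.1 v.1) * ((r ^ genDist u.1 v.1)⁻¹ * (r ^ genDist u.1 v.1)⁻¹) := by ring
      _ = _ := by rw [hunit, hσ, inv_mul_cancel₀ (pow_ne_zero 2 hκ0), mul_inv]; ring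
  have hκ2 : (κ ^ 2)⁻¹ ≠ 0 := inv_ne_zero (pow_ne_zero 2 hκ0)
  rcases Nat.even_or_odd' j with ⟨i, rfl | rfl⟩
  · obtain ⟨c, hc, hMi⟩ := hM i (by omega)
    -- The 1/2 is the normalization of the lift.
    refine ⟨C (c / 2) * (f i).comp (C (κ ^ 2)⁻¹ * X ^ 2),
      degree_C_mul_comp_sq (hf i) (by positivity) hκ2, fun u v => ?_⟩
    rw [eval_mul, eval_C, eval_comp, eval_mul, eval_C, eval_pow, eval_X, h2, liftAlt,
      if_pos (by simp), Nat.mul_div_cancel_left _ two_pos, liftEven, Matrix.of_apply, hMi,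
      sum_smul_signedDist_apply hB _ (fun k => c * (1 ^ k)⁻¹ * (f i).eval (q ^ k)⁻¹), one_pow]
    ring
  · obtain ⟨c, hc, hNi⟩ := hN i (by omega)
    -- The extra factor X supplies κ εε'σ r^(-d); dividing by κ restores the constant.
    refine ⟨C (c / (2 * κ)) * (g i).comp (C (κ ^ 2)⁻¹ * X ^ 2) * X, ?_, fun u v => ?_⟩
    · rw [degree_mul, degree_C_mul_comp_sq (hg i) (by positivity) hκ2, degree_X]
      push_cast; rfl
    · rw [eval_mul, eval_mul, eval_C, eval_comp, eval_mul, eval_C, eval_pow, eval_X, h2, h1,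
        liftAlt, if_neg (by simp), show (2 * i + 1) / 2 = i by omega, liftOdd, Matrix.of_apply, hNi,
        sum_smul_signedDist_apply hB _ (fun k => c * (r ^ k)⁻¹ * (g i).eval (q ^ k)⁻¹)]
      field_simp

end DualPolarCover

end

theorem corollary8p2
    {F : Type*} [Field F] [Fintype F] [DecidableEq F] (hq : Fintype.card F % 4 = 1)
    {V : Type*} [AddCommGroup V] [Module F V] [Finite V]
    (n : ℕ) (hn : 1 ≤ n) (hV : Module.finrank F V = 2 * n)
    (B : LinearMap.BilinForm F V) (hBalt : B.IsAlt) (hBnondeg : B.Nondegenerate)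
    (δ : ∀ X : DualPolarCover.Generator B, X.1 [⋀^Fin n]→ₗ[F] F) (hδ : ∀ X, δ X ≠ 0) :
    DualPolarCover.IsAssociationScheme (DualPolarCover.coverRel δ) ∧
    ∃ (E : Fin (2 * n + 1 + 1) →
          Matrix (DualPolarCover.CoverVertex B) (DualPolarCover.CoverVertex B) ℝ)
      (P : Matrix (Fin (2 * n + 1 + 1)) (Fin (2 * n + 1 + 1)) ℝ),
      DualPolarCover.IsQPolynomialOrdering (DualPolarCover.coverRel δ) E ∧
      DualPolarCover.IsPMatrix (DualPolarCover.coverRel δ) E P ∧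
      ∀ (i j j' : Fin (2 * n + 1 + 1)), (j : ℕ) ≤ n → (j' : ℕ) = 2 * n + 1 - j →
        (Even (i : ℕ) →
          P i j = P i j' ∧
          P i j = DualPolarCover.PTilde (Fintype.card F) n ((i : ℕ) / 2) j) ∧
        (Odd (i : ℕ) →
          P i j = -P i j' ∧
          P i j = DualPolarCover.PHat (Fintype.card F) n ((i : ℕ) / 2) j) := by
  classical
  open DualPolarCover in
  have hB : IsSymplectic B n := ⟨hBalt, hBnondeg, hV⟩
  have : Nonempty (Generator B) := hB.nonempty_generator
  set q : ℝ := (Fintype.card F : ℝ) with hqdef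
  have hq1 : 1 < q := by rw [hqdef]; exact_mod_cast Fintype.one_lt_card
  have hq0 : 0 < q := by linarith
  have hr0 : 0 < Real.sqrt q := Real.sqrt_pos.2 hq0
  have hrr : Real.sqrt q * Real.sqrt q = q := Real.mul_self_sqrt hq0.le
  set σ : Generator B → Generator B → ℝ := fun X Y => (maslovIndex δ X Y : ℝ) with hσ
  have hσi := isTriangleIndex_maslovIndex hB hq hδ
  have hT : IsRecurrent q q 1 n (signedDist (B := B) fun _ _ => 1) :=
    (isTriangleIndex_one hB hq hδ).isRecurrent hB sum_ite_zero
  have hS : IsRecurrent q (Real.sqrt q) (Real.sqrt q) n (signedDist σ) :=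
    -- The quadratic character sums to 0, so a = b, and ab = q forces both to be √q.
    hσi.isRecurrent hB ((sum_quadraticChar hq).trans (sub_self _).symm)
  set M := specIdem q q 1 n (signedDist (B := B) fun _ _ => 1) with hM
  set N := specIdem q (Real.sqrt q) (Real.sqrt q) n (signedDist σ) with hN
  let E : Fin (2 * n + 1 + 1) → Matrix (CoverVertex B) (CoverVertex B) ℝ := fun i => liftAlt M N i
  let P : Matrix (Fin (2 * n + 1 + 1)) (Fin (2 * n + 1 + 1)) ℝ :=
    Matrix.of fun i j => coverP q n i j
  have hE : ∀ i j, E i * E j = if i = j then E i else 0 := by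
    intro i j
    have h := liftAlt_mul (M := M) (N := N) (n := n)
      (fun i j hi hj => hT.specIdem_mul hq1 (mul_one q) hq0 one_pos hi hj)
      (fun i j hi hj => hS.specIdem_mul hq1 hrr hr0 hr0 hi hj) i.2 j.2
    simpa [E, Fin.ext_iff] using h
  have hP : IsPMatrix (coverRel δ) E P := by
    intro j
    rw [adjMatrix_coverRel hB hδ, hT.eq_sum_specIdem hq1 (mul_one q) hq0 one_pos,
      hS.eq_sum_specIdem hq1 hrr hr0 hr0, liftEven_sum, liftOdd_sum, Finset.smul_sum]
    change _ = ∑ i : Fin (2 * n + 1 + 1), (fun i : ℕ => coverP q n i j • liftAlt M N i) i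
    rw [← Finset.sum_range (fun i : ℕ => coverP q n i j • liftAlt M N i)]
    generalize (j : ℕ) = m
    -- Even indices carry the fibre-constant part of A_j, odd ones the sign-changing part.
    rw [show 2 * n + 1 + 1 = 2 * (n + 1) by ring, sum_range_two_mul]
    congr 1
    · refine Finset.sum_congr rfl fun k _ => ?_
      rw [coverP, liftAlt, if_pos (by simp), if_pos (by simp),
        Nat.mul_div_cancel_left _ two_pos]
    · refine Finset.sum_congr rfl fun k _ => ?_
      rw [coverP, liftAlt, if_neg (by simp), if_neg (by simp),
        show (2 * k + 1) / 2 = k by omega, smul_smul]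
  have hpart := coverRel_existsUnique hB hδ
  have hne := coverRel_nonempty hB hq hδ
  refine ⟨⟨hpart, hne, coverRel_zero hB hδ, coverRel_symm hB hq,
    exists_intersection_of_orthogonal hpart hne hE hP⟩, E, P,
    ⟨isIdempotentOrdering_of_orthogonal hpart hne hE hP, fun j => ?_⟩, hP, fun i j j' hj hj' => ?_⟩
  · exact exists_polynomial_liftAlt hB hσi.sq hr0.ne' hrr
      (fun i => degree_dualPoly hq1 hq0 one_pos n i) (fun i => degree_dualPoly hq1 hr0 hr0 n i)
      (fun i hi => hT.specIdem_eq hq1 (mul_one q) hq0 one_pos hi)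
      (fun i hi => hS.specIdem_eq hq1 hrr hr0 hr0 hi) j.2
  · have h1 : foldIndex n j = j := by rw [foldIndex, if_pos hj]
    have h2 : foldIndex n j' = j := by rw [foldIndex, if_neg (by omega), hj']; omega
    have h3 : foldSign n j = 1 := by rw [foldSign, if_pos hj]
    have h4 : foldSign n j' = -1 := by rw [foldSign, if_neg (by omega)]
    refine ⟨fun hi => ?_, fun hi => ?_⟩
    · simp only [P, Matrix.of_apply, coverP, if_pos hi, h1, h2, true_and]
      exact (PTilde_eq_pEntry hq0.le n _ _).symm
    · simp only [P, Matrix.of_apply, coverP, if_neg (Nat.not_even_iff_odd.2 hi), h1, h2, h3, h4,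
        PHat_eq_pEntry hq0.le]
      norm_num
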